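/- **Conventions.** A *real algebra* is a real vector space $A$ with a bilinear multiplication (not assumed associative or unital). Its *motor domain* $M_A$ is the closure of the set of nonzero elements of $A$ under multiplication. $A$ is *rational* if it is finite dimensional and $M_A$ is a monoid (associative, with identity); it is *consistent* if moreover the category of sets with a left $M_A$-action is a boolean topos. A *home paradigm* is a consistent real algebra of maximal dimension among consistent real algebras. For rational $A$ let $\mathcal A^\bullet$ (the *perception domain*) be the set of invertible elements, with all tangent spaces identified with $A$. For $u\in A$ the left invariant field generated by $u$ is $a\mapsto au$. The *structure field* is the left invariant $(1,2)$-tensor field on $\mathcal A^\bullet$ with $\mathcal A_a(au,av)=a(uv)$. Fix $1\le k\le\infty$. A *cosmology* is a triple $(A,\preceq,\mathfrak T)$ where $A$ is a rational real algebra isomorphic to a home paradigm, $\preceq$ is a partial order on $A$, $\mathfrak T:A\to\mathbb R$ is such that $a\preceq b\iff(\mathfrak T(a)<\mathfrak T(b)$ or $a=b)$, the restriction $\mathcal T$ of $\mathfrak T$ to $\mathcal A^\bullet$ is of class $C^k$, and the tensor field $\boldsymbol{\mathcal T}_a(x,y):=d\mathcal T_a(\mathcal A_a(x,y))$ is symmetric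 and nondegenerate at each $a\in\mathcal A^\bullet$ (a *principal metric*; it is the *metric* of the cosmology, and $(\mathcal A^\bullet,\boldsymbol{\mathcal T})$ is its *spacetime*). As $\preceq$ is determined by $\mathfrak T$, we write $(A,\mathfrak T)$. Let $\mathbb H$ be the quaternion algebra and $\mathcal H^\circ=\mathbb H\setminus\{0\}$. A basis $(i_0,i_1,i_2,i_3)$ of $\mathbb H$ is *canonical* if it multiplies like $(1,i,j,k)$. For a canonical basis with coordinates $(w,x,y,z)$ and a function $R:\mathbb R\to\mathbb R$, spherical coordinates $(\eta,\chi,\theta,\varphi)$ are given by $$w=R(\eta)\cos\chi,\quad x=R(\eta)\sin\chi\sin\theta\cos\varphi,\quad y=R(\eta)\sin\chi\sin\theta\sin\varphi,\quad z=R(\eta)\sin\chi\cos\theta,$$ with frame $(\partial_\eta,\partial_\chi,\partial_\theta,\partial_\varphi)$; it is considered where $R$ is differentiable and $R\ne0$. A dot denotes $d/d\eta$. **Theorem.** There is a function $\mathfrak T$ such that $(\mathbb H,\mathfrak T)$ is a cosmology. Every cosmology $(A,\mathfrak T)$ is carried by an algebra isomorphism $A\cong\mathbb H$ to a cosmology of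 the form $(\mathbb H,\mathfrak T')$. Moreover: 1. The perception domain of $\mathbb H$ is the Lie group $\mathcal H^\circ$ of nonzero quaternions; it is homeomorphic to $\mathbb R\times\mathbb S^3$. 2. It is a smooth manifold of dimension four, and the metric of every cosmology $(\mathbb H,\mathfrak T)$ is closed FLRW: up to an overall sign (the choice between the conventions $(+,-,-,-)$ and $(-,+,+,+)$), the spacetime is isometric, by a $C^k$ diffeomorphism, to $I\times\mathbb S^3$ with $d\eta^2-\mathfrak a(\eta)^2h$, where $I$ is an open interval, $\mathfrak a>0$, and $h$ is the metric of the unit three-sphere. 3. For every cosmology $(\mathbb H,\mathfrak T)$ there is $\varepsilon=\pm1$, with $\varepsilon=1$ if $\mathcal T$ is strictly increasing in $|a|$ and $\varepsilon=-1$ if it is strictly decreasing in $|a|$ (one of these holds), such that for all canonical bases, all signs $s=\pm1$ and all $R$, at every point where $R\neq 0$, $\dot R\ne0$ and $\dot R/R=s/|\dot{\mathcal T}|$, the metric has the components $$\boldsymbol{\mathcal T}_{\alpha\beta}=\varepsilon\,\mathrm{diag}(1,-\mathfrak a^2,-\mathfrak a^2\sin^2\chi,-\mathfrak a^2\sin^2\chi\sin^2\theta),\qquad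 \mathfrak a:=|\dot{\mathcal T}|=\sqrt{|d\mathcal T_a(a)|}$$ (here $d\mathcal T_a(a)$ is the derivative of $\mathcal T$ at the point $a$ along the left invariant field generated by $1$). For each sign $s$ there are an open interval $I$ and a $C^k$ bijection $R:I\to(0,\infty)$ with $\dot R\ne0$ such that, along every ray $\eta\mapsto R(\eta)p$ with $|p|=1$, $\dot R/R=s/|\dot{\mathcal T}|$ on $I$, that is, $R(\eta)=R(\eta_0)\exp\int_{\eta_0}^{\eta}\frac{s\,d\eta}{|\dot{\mathcal T}|}$ for all $\eta_0,\eta\in I$. 4. For every cosmology $(\mathbb H,\mathfrak T)$, every canonical basis and every $R$ that is nonzero and differentiable with $\dot R\ne0$ on an interval, $\mathcal T$ is on that interval a function of $\eta$ alone, and it is strictly monotone in $\eta$. 5. For every canonical basis, where $R\ne0$, $\dot R\ne0$, $\sin\chi\ne0$ and $\sin\theta\neq0$, the spherical frame is linearly independent and, with $\lambda:=\dot R/R$, the structure field of $\mathbb H$ has in it the components $$\mathcal H^0_{\alpha\beta}=\mathrm{diag}(\lambda,-\lambda^{-1},-\lambda^{-1}\sin^2\chi,-\lambda^{-1}\sin^2\chi\sin^2\theta),$$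 $$\mathcal H^1_{\alpha\beta}=\begin{pmatrix}0&\lambda&0&0\\\lambda&0&0&0\\0&0&0&\sin^2\chi\sin\theta\\0&0&-\sin^2\chi\sin\theta&0\end{pmatrix},\quad \mathcal H^2_{\alpha\beta}=\begin{pmatrix}0&0&\lambda&0\\0&0&0&-\sin\theta\\\lambda&0&0&0\\0&\sin\theta&0&0\end{pmatrix},\quad \mathcal H^3_{\alpha\beta}=\begin{pmatrix}0&0&0&\lambda\\0&0&1/\sin\theta&0\\0&-1/\sin\theta&0&0\\\lambda&0&0&0\end{pmatrix}.$$ 6. For every cosmology $(\mathbb H,\mathfrak T)$ and every canonical basis, wherever $R\neq 0$ is differentiable, $d\mathcal T$ has the components $(\dot{\mathcal T},0,0,0)$, that is, it takes these values on $\partial_\eta,\partial_\chi,\partial_\theta,\partial_\varphi$. 7. Given a canonical basis, let $u\in\mathbb H$ have the components $(u^0,u^1,u^2,u^3)$, let $a\in\mathcal H^\circ$ have the coordinates $(\bar w,\bar x,\bar y,\bar z)$, and let $\omega=\sqrt{(u^1)^2+(u^2)^2+(u^3)^2}$. On every open interval containing $0$, the $(u,a)$-vista, i.e. the integral curve in $\mathcal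 H^\circ$ of the left invariant field generated by $u$ that is at $a$ at time $0$, exists, is unique, and is $$\begin{aligned} w(t)&=e^{u^0t}\Big(\tfrac{-u^1\bar x-u^2\bar y-u^3\bar z}{\omega}\sin\omega t+\bar w\cos\omega t\Big),& x(t)&=e^{u^0t}\Big(\tfrac{u^1\bar w-u^2\bar z+u^3\bar y}{\omega}\sin\omega t+\bar x\cos\omega t\Big),\\ y(t)&=e^{u^0t}\Big(\tfrac{u^1\bar z+u^2\bar w-u^3\bar x}{\omega}\sin\omega t+\bar y\cos\omega t\Big),& z(t)&=e^{u^0t}\Big(\tfrac{-u^1\bar y+u^2\bar x+u^3\bar w}{\omega}\sin\omega t+\bar z\cos\omega t\Big), \end{aligned}$$ where the terms with $\sin\omega t$ are read as $0$ if $\omega=0$. -/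

import Mathlib

open CategoryTheory CategoryTheory.Limits

/-! ### Boolean toposes -/

/-- A category is a boolean topos if it has finite limits, is cartesian closed, has a subobject
classifier, and every subobject of every object has a complement. -/
def IsBooleanTopos (C : Type*) [Category C] : Prop :=
  ∃ _ : HasFiniteLimits C,
    (∀ X : C, (prod.functor.obj X).IsLeftAdjoint) ∧
    HasSubobjectClassifier C ∧
    ∀ (X : C) (S : Subobject X), ∃ S' : Subobject X,
      (∀ U : Subobject X, U ≤ S → U ≤ S' → ∀ V : Subobject X, U ≤ V) ∧
      (∀ U : Subobject X, S ≤ U → S' ≤ U → U = ⊤)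

/-! ### Paradigms of the observer

The existent paradigms of the observer are the real algebras: real vector spaces with a bilinear
multiplication, not assumed to be associative, commutative or unital. -/

/-- The motor domain: the multiplicative subgroupoid generated by the nonzero elements. -/
def motorDomain (A : Type) [NonUnitalNonAssocRing A] : Subsemigroup A :=
  Subsemigroup.closure {a : A | a ≠ 0}

/-- The motor domain is a monoid for the multiplication of the algebra. -/
structure MotorIsMonoid (A : Type) [NonUnitalNonAssocRing A] : Prop where
  assoc : ∀ x y z : motorDomain A, x * y * z = x * (y * z)
  exists_one : ∃ e : motorDomain A, ∀ x : motorDomain A, e * x = x ∧ x * e = x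

/-- The monoid structure of the motor domain. -/
@[reducible] noncomputable def MotorIsMonoid.monoid {A : Type} [NonUnitalNonAssocRing A]
    (h : MotorIsMonoid A) : Monoid (motorDomain A) where
  mul x y := x * y
  mul_assoc := h.assoc
  one := h.exists_one.choose
  one_mul x := (h.exists_one.choose_spec x).1
  mul_one x := (h.exists_one.choose_spec x).2

/-- The category of sets with a left action of the motor domain. -/
abbrev ParadigmUniverse {A : Type} [NonUnitalNonAssocRing A] (h : MotorIsMonoid A) :=
  @Action Type _ (motorDomain A) h.monoid

/-- A rational paradigm: a finite dimensional algebra whose motor domain is a monoid. -/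
def IsRationalParadigm (A : Type) [NonUnitalNonAssocRing A] [Module ℝ A]
    [IsScalarTower ℝ A A] [SMulCommClass ℝ A A] : Prop :=
  Module.Finite ℝ A ∧ MotorIsMonoid A

/-- A consistent paradigm: a rational one whose universe is a boolean topos. -/
def IsConsistentParadigm (A : Type) [NonUnitalNonAssocRing A] [Module ℝ A]
    [IsScalarTower ℝ A A] [SMulCommClass ℝ A A] : Prop :=
  IsRationalParadigm A ∧ ∃ h : MotorIsMonoid A, IsBooleanTopos (ParadigmUniverse h)

/-- A home paradigm: a consistent paradigm of maximal dimension. -/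
def IsHomeParadigm (A : Type) [NonUnitalNonAssocRing A] [Module ℝ A]
    [IsScalarTower ℝ A A] [SMulCommClass ℝ A A] : Prop :=
  IsConsistentParadigm A ∧
    ∀ (B : Type) [NonUnitalNonAssocRing B] [Module ℝ B] [IsScalarTower ℝ B B]
      [SMulCommClass ℝ B B], IsConsistentParadigm B → Module.finrank ℝ B ≤ Module.finrank ℝ A

/-- The perception domain: the set of invertible elements. -/
def perceptionDomain (A : Type) [NonUnitalNonAssocRing A] : Set A :=
  {a | ∃ e b : A, (∀ x, e * x = x ∧ x * e = x) ∧ a * b = e ∧ b * a = e}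

/-! ### Structure field and principal metrics

The tangent space at each point of the perception domain is identified with the algebra itself. The
left invariant vector field generated by `u` is `a ↦ a * u`. -/

open Classical in
/-- For invertible `a`, the vector `u` whose left invariant field takes the value `x` at `a`. -/
noncomputable def leftDiv {A : Type} [NonUnitalNonAssocRing A] (a x : A) : A :=
  if h : ∃ u, a * u = x then h.choose else 0

/-- The structure field: the left invariant tensor field of type `(1, 2)` on the perception domain
whose components in a frame of left invariant fields are the structure constants of the algebra, so
that its value at `(a * u, a * v)` over `a` is `a * (u * v)`. -/
noncomputable def structureField {A : Type} [NonUnitalNonAssocRing A] (a x y : A) : A :=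
  a * (leftDiv a x * leftDiv a y)

/-- The contraction of `dT` with the structure field. -/
noncomputable def principalMetric {A : Type} [NonUnitalNonAssocRing A] [Module ℝ A]
    (T : A → ℝ) (a x y : A) : ℝ :=
  lineDeriv ℝ T a (structureField a x y)

/-- The restriction of `T` to the perception domain is of class `C^k` (in linear coordinates) and
generates a principal metric: the contraction of `dT` with the structure field is a metric, that is,
symmetric and nondegenerate at each point of the perception domain. -/
def GeneratesPrincipalMetric (k : ℕ∞) (A : Type) [NonUnitalNonAssocRing A] [Module ℝ A]
    (T : A → ℝ) : Prop :=
  (∃ (n : ℕ) (b : Module.Basis (Fin n) ℝ A),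
    ContDiffOn ℝ k (fun c : Fin n → ℝ => T (b.equivFun.symm c))
      {c | b.equivFun.symm c ∈ perceptionDomain A}) ∧
  ∀ a ∈ perceptionDomain A,
    (∀ x y, principalMetric T a x y = principalMetric T a y x) ∧
    (∀ x, (∀ y, principalMetric T a x y = 0) → x = 0)

/-! ### Realities -/

/-- The temporal order of a global time `T`. -/
def temporalOrder {A : Type} (T : A → ℝ) (a b : A) : Prop := T a < T b ∨ a = b

/-- `(A, R, T)` is a temporal reality: `A` is rational, the ontology `R` is a partial order, and
`R` is the temporal order of the global time `T`. -/
def IsTemporalReality (A : Type) [NonUnitalNonAssocRing A] [Module ℝ A] [IsScalarTower ℝ A A]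
    [SMulCommClass ℝ A A] (R : A → A → Prop) (T : A → ℝ) : Prop :=
  IsRationalParadigm A ∧ IsPartialOrder A R ∧ ∀ a b, R a b ↔ temporalOrder T a b

/-- A robust reality: a temporal one whose perceptible time generates a principal metric. -/
def IsRobustReality (k : ℕ∞) (A : Type) [NonUnitalNonAssocRing A] [Module ℝ A]
    [IsScalarTower ℝ A A] [SMulCommClass ℝ A A] (R : A → A → Prop) (T : A → ℝ) : Prop :=
  IsTemporalReality A R T ∧ GeneratesPrincipalMetric k A T

/-- A cosmology: a robust reality whose underlying paradigm is isomorphic to a home paradigm. -/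
def IsCosmology (k : ℕ∞) (A : Type) [NonUnitalNonAssocRing A] [Module ℝ A]
    [IsScalarTower ℝ A A] [SMulCommClass ℝ A A] (R : A → A → Prop) (T : A → ℝ) : Prop :=
  IsRobustReality k A R T ∧
    ∃ (B : Type) (_ : NonUnitalNonAssocRing B) (_ : Module ℝ B) (_ : IsScalarTower ℝ B B)
      (_ : SMulCommClass ℝ B B), IsHomeParadigm B ∧
        ∃ φ : A ≃ₗ[ℝ] B, ∀ x y, φ (x * y) = φ x * φ y

/-! ### Closed FLRW metrics -/

/-- `g` is a closed FLRW metric of class `C^k` on the open set `U` of `E`: up to the choice between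
the sign conventions `(+,-,-,-)` and `(-,+,+,+)` it is isometric, by a diffeomorphism `Ψ`, to
`dη² - 𝔞(η)² h` on `I × S³`, where `I` is an open interval, `𝔞 > 0`, and `h` is the metric of the
unit three-sphere. -/
def IsClosedFLRW (k : ℕ∞) {E : Type*} [NormedAddCommGroup E] [NormedSpace ℝ E] (U : Set E)
    (g : E → E → E → ℝ) : Prop :=
  ∃ (I : Set ℝ) (scale : ℝ → ℝ) (ε : ℝ) (Ψ : ℝ × EuclideanSpace ℝ (Fin 4) → E),
    IsOpen I ∧ I.OrdConnected ∧ I.Nonempty ∧ (∀ η ∈ I, 0 < scale η) ∧ (ε = 1 ∨ ε = -1) ∧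
    ContDiffOn ℝ k Ψ (I ×ˢ {0}ᶜ) ∧
    Set.BijOn Ψ (I ×ˢ Metric.sphere 0 1) U ∧
    ∀ η ∈ I, ∀ p ∈ Metric.sphere (0 : EuclideanSpace ℝ (Fin 4)) 1,
      ∀ (x y : ℝ) (v w : EuclideanSpace ℝ (Fin 4)), inner ℝ p v = 0 → inner ℝ p w = 0 →
        g (Ψ (η, p)) (fderiv ℝ Ψ (η, p) (x, v)) (fderiv ℝ Ψ (η, p) (y, w)) =
          ε * (x * y - scale η ^ 2 * inner ℝ v w)

/-! ### Canonical bases, spherical coordinates and vistas for the quaternion algebra -/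

/-- The structure constants of the quaternions, `(γ, α, β) ↦ H^γ_{αβ}`. -/
def canonicalConstants : Fin 4 → Matrix (Fin 4) (Fin 4) ℝ :=
  ![!![1, 0, 0, 0; 0, -1, 0, 0; 0, 0, -1, 0; 0, 0, 0, -1],
    !![0, 1, 0, 0; 1, 0, 0, 0; 0, 0, 0, 1; 0, 0, -1, 0],
    !![0, 0, 1, 0; 0, 0, 0, -1; 1, 0, 0, 0; 0, 1, 0, 0],
    !![0, 0, 0, 1; 0, 0, 1, 0; 0, -1, 0, 0; 1, 0, 0, 0]]

/-- A canonical basis of the quaternion algebra. -/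
def IsCanonicalBasis (b : Module.Basis (Fin 4) ℝ (Quaternion ℝ)) : Prop :=
  ∀ α β, b α * b β = ∑ γ, canonicalConstants γ α β • b γ

/-- The point with spherical coordinates `q = (η, χ, θ, φ)`, for the radial function `R`. -/
noncomputable def sphericalPoint (b : Module.Basis (Fin 4) ℝ (Quaternion ℝ)) (R : ℝ → ℝ)
    (q : Fin 4 → ℝ) : Quaternion ℝ :=
  (R (q 0) * Real.cos (q 1)) • b 0 +
  (R (q 0) * Real.sin (q 1) * Real.sin (q 2) * Real.cos (q 3)) • b 1 +
  (R (q 0) * Real.sin (q 1) * Real.sin (q 2) * Real.sin (q 3)) • b 2 +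
  (R (q 0) * Real.sin (q 1) * Real.cos (q 2)) • b 3

/-- The spherical coordinate frame: the derivatives of `sphericalPoint` in `η, χ, θ, φ`. -/
noncomputable def sphericalFrame (b : Module.Basis (Fin 4) ℝ (Quaternion ℝ)) (R : ℝ → ℝ)
    (q : Fin 4 → ℝ) (α : Fin 4) : Quaternion ℝ :=
  deriv (fun s => sphericalPoint b R (Function.update q α s)) (q α)

/-- The derivative of `T` in `η` at the point with spherical coordinates `q`. -/
noncomputable def etaDeriv (b : Module.Basis (Fin 4) ℝ (Quaternion ℝ)) (R : ℝ → ℝ)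
    (T : Quaternion ℝ → ℝ) (q : Fin 4 → ℝ) : ℝ :=
  deriv (fun s => T (sphericalPoint b R (Function.update q 0 s))) (q 0)

/-- The components `(γ, α, β) ↦ H^γ_{αβ}` of the structure field in the spherical frame. -/
noncomputable def sphericalConstants (l χ θ : ℝ) : Fin 4 → Matrix (Fin 4) (Fin 4) ℝ :=
  ![!![l, 0, 0, 0;
       0, -l⁻¹, 0, 0;
       0, 0, -l⁻¹ * Real.sin χ ^ 2, 0;
       0, 0, 0, -l⁻¹ * Real.sin χ ^ 2 * Real.sin θ ^ 2],
    !![0, l, 0, 0;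
       l, 0, 0, 0;
       0, 0, 0, Real.sin χ ^ 2 * Real.sin θ;
       0, 0, -(Real.sin χ ^ 2 * Real.sin θ), 0],
    !![0, 0, l, 0;
       0, 0, 0, -Real.sin θ;
       l, 0, 0, 0;
       0, Real.sin θ, 0, 0],
    !![0, 0, 0, l;
       0, 0, 1 / Real.sin θ, 0;
       0, -(1 / Real.sin θ), 0, 0;
       l, 0, 0, 0]]

/-- `γ` is, on the time set `J`, an integral curve through `a` of the left invariant vector field
on the nonzero quaternions generated by `u`. -/
def IsVistaOn (J : Set ℝ) (u a : Quaternion ℝ) (γ : ℝ → Quaternion ℝ) : Prop :=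
  γ 0 = a ∧ (∀ t ∈ J, γ t ≠ 0) ∧ IsIntegralCurveOn γ (fun _ x => x * u) J

/-- The explicit coordinates of the vista at time `t`; with `ω = 0` the quotients by `ω` are `0`,
as are their numerators. -/
noncomputable def vistaCoords (u a : Fin 4 → ℝ) (t : ℝ) : Fin 4 → ℝ :=
  let ω := Real.sqrt (u 1 ^ 2 + u 2 ^ 2 + u 3 ^ 2)
  ![Real.exp (u 0 * t) * ((-u 1 * a 1 - u 2 * a 2 - u 3 * a 3) / ω * Real.sin (ω * t)
      + a 0 * Real.cos (ω * t)),
    Real.exp (u 0 * t) * ((u 1 * a 0 - u 2 * a 3 + u 3 * a 2) / ω * Real.sin (ω * t)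
      + a 1 * Real.cos (ω * t)),
    Real.exp (u 0 * t) * ((u 1 * a 3 + u 2 * a 0 - u 3 * a 1) / ω * Real.sin (ω * t)
      + a 2 * Real.cos (ω * t)),
    Real.exp (u 0 * t) * ((-u 1 * a 2 + u 2 * a 1 + u 3 * a 0) / ω * Real.sin (ω * t)
      + a 3 * Real.cos (ω * t))]

/-! ### Monoid actions form a boolean topos exactly for groups. -/

section BooleanTopos

variable {M : Type} [Monoid M]

/-! Two rigidity facts carry the theorem: the algebra must be the quaternions, and the time must be
a function of the norm.

Subobjects of an M-set are its invariant subsets. Over a group their set complements are invariant;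
conversely, complementing the left ideal Mm in M itself produces a left inverse of m
(`isBooleanTopos_action`, `exists_left_inv_of_isBooleanTopos`). Hence consistent algebras are
associative division algebras, and Frobenius' theorem leaves dimension at most two or the
quaternions, which are therefore the home paradigm.

On the quaternions the structure field is x a⁻¹ y. Symmetry of its contraction with dT says that dT
kills a(uv - vu). Commutators span the imaginary quaternions, so T is constant on spheres and T(a) =
f(|a|); nondegeneracy forces f' ≠ 0 (`GeneratesPrincipalMetric.exists_hasRadialProfile`). With r =
|a|, `Quaternion.inner_mul_inv_mul` turns the metric into (f'(r)/r)(2⟨a,x⟩⟨a,y⟩/r² - ⟨x,y⟩), which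
is f'(r)/r on radial unit vectors and -f'(r)/r on tangential ones. Normalising the radial part by dη
= ±√(|f'|/r) dr gives the closed FLRW form with scale factor √(|f'| r) = |dT/dη|.

The coordinate formulas reduce to quaternion arithmetic in standard coordinates, because algebra
endomorphisms of the quaternions are isometries and one of them aligns the standard basis with the
spherical directions. The vistas are a exp(tu). -/

theorem Action.map_smul_apply {X Y : Action Type M} (f : X ⟶ Y) (g : M) (x : X.V) :
    f.hom (X.ρ g x) = Y.ρ g (f.hom x) :=
  types_congr_hom (f.comm g) x

theorem Action.mono_iff_injective {X Y : Action Type M} (f : X ⟶ Y) :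
    Mono f ↔ Function.Injective f.hom := by
  rw [← CategoryTheory.mono_iff_injective]
  constructor
  · intro h
    exact inferInstanceAs (Mono ((Action.forget Type M).map f))
  · intro h
    exact (Action.forget Type M).mono_of_mono_map h

/-- The inclusion of an invariant subset. -/
def Action.invariantSubset (X : Action Type M) (s : Set X.V) (hs : ∀ g, ∀ x ∈ s, X.ρ g x ∈ s) :
    Action Type M where
  V := s
  ρ :=
    { toFun g := TypeCat.ofHom fun x : s => (⟨X.ρ g x, hs g x x.2⟩ : s)
      map_one' := by
        refine ConcreteCategory.hom_ext _ _ fun x => Subtype.ext ?_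
        exact congrArg (fun f : End X.V => f x.1) (map_one X.ρ)
      map_mul' g h := by
        refine ConcreteCategory.hom_ext _ _ fun x => Subtype.ext ?_
        exact congrArg (fun f : End X.V => f x.1) (map_mul X.ρ g h) }

def Action.invariantSubsetι (X : Action Type M) (s : Set X.V) (hs : ∀ g, ∀ x ∈ s, X.ρ g x ∈ s) :
    X.invariantSubset s hs ⟶ X where
  hom := TypeCat.ofHom Subtype.val
  comm g := by ext x; rfl

instance (X : Action Type M) (s : Set X.V) (hs : ∀ g, ∀ x ∈ s, X.ρ g x ∈ s) :
    Mono (X.invariantSubsetι s hs) :=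
  (Action.mono_iff_injective _).2 Subtype.val_injective

/-- The underlying set of a subobject. -/
def Action.carrier {X : Action Type M} (S : Subobject X) : Set X.V := Set.range S.arrow.hom

theorem Action.carrier_smul_mem {X : Action Type M} (S : Subobject X) (g : M) {x : X.V}
    (hx : x ∈ Action.carrier S) : X.ρ g x ∈ Action.carrier S := by
  obtain ⟨y, rfl⟩ := hx
  exact ⟨_, Action.map_smul_apply S.arrow g y⟩

theorem Action.carrier_mono {X : Action Type M} {S U : Subobject X} (h : S ≤ U) :
    Action.carrier S ⊆ Action.carrier U := by
  rintro _ ⟨y, rfl⟩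
  refine ⟨(Subobject.ofLE S U h).hom y, ?_⟩
  have := congrArg Action.Hom.hom (Subobject.ofLE_arrow h)
  exact types_congr_hom this y

theorem Action.carrier_mk {X Y : Action Type M} (f : Y ⟶ X) [Mono f] :
    Action.carrier (Subobject.mk f) = Set.range f.hom := by
  have h1 := congrArg Action.Hom.hom (Subobject.underlyingIso_hom_comp_eq_mk f)
  have h2 := congrArg Action.Hom.hom (Subobject.underlyingIso_arrow f)
  ext x
  constructor
  · rintro ⟨y, rfl⟩
    exact ⟨_, types_congr_hom h1 y⟩
  · rintro ⟨y, rfl⟩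
    exact ⟨_, types_congr_hom h2 y⟩

theorem Action.carrier_mk_invariantSubset (X : Action Type M) (s : Set X.V)
    (hs : ∀ g, ∀ x ∈ s, X.ρ g x ∈ s) :
    Action.carrier (Subobject.mk (X.invariantSubsetι s hs)) = s :=
  (Action.carrier_mk _).trans Subtype.range_coe

theorem Action.le_of_carrier_eq_empty {X : Action Type M} {U : Subobject X}
    (h : Action.carrier U = ∅) (V : Subobject X) : U ≤ V := by
  have : IsEmpty (U : Action Type M).V := Set.range_eq_empty_iff.1 h
  refine Subobject.le_of_comm ⟨TypeCat.ofHom fun x => isEmptyElim x, fun g => ?_⟩ ?_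
  · ext x
    exact isEmptyElim x
  · ext x
    exact isEmptyElim x

theorem Action.eq_top_of_carrier_eq_univ {X : Action Type M} {U : Subobject X}
    (h : Action.carrier U = Set.univ) : U = ⊤ := by
  have : IsIso U.arrow.hom := (isIso_iff_bijective _).2
    ⟨(Action.mono_iff_injective _).1 inferInstance, Set.range_eq_univ.1 h⟩
  have : IsIso U.arrow := Action.isIso_of_hom_isIso _
  exact Subobject.eq_top_of_isIso_arrow U

/-- Actions are functors on the one-object category of M, and cartesian closedness passes along that
equivalence. -/
theorem Action.prodFunctor_isLeftAdjoint (X : Action Type M) :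
    (prod.functor.obj X).IsLeftAdjoint := by
  let C : CartesianMonoidalCategory (Action Type M) := .ofHasFiniteProducts
  have h : @MonoidalClosed (Action Type M) _ C.toMonoidalCategory :=
    cartesianClosedOfEquiv (Action.functorCategoryEquivalence Type M).symm
  exact @CartesianMonoidalCategory.isLeftAdjoint_prod_functor _ _ C X (h.closed X)

theorem Action.hasSubobjectClassifier : HasSubobjectClassifier (Action Type M) := by
  -- The double opposite presents actions as presheaves, whose subobject classifier is then
  -- transported along `e`.
  let e : ((SingleObj M)ᵒᵖᵒᵖ ⥤ Type) ≌ Action Type M :=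
    (Equivalence.congrLeft (E := Type) (opOpEquivalence (SingleObj M))).trans
      (Action.functorCategoryEquivalence Type M).symm
  have h : HasSubobjectClassifier ((SingleObj M)ᵒᵖᵒᵖ ⥤ Type) := inferInstance
  exact ⟨⟨h.exists_classifier.some.ofEquivalence e⟩⟩

/-- The actions of a group form a boolean topos. -/
theorem isBooleanTopos_action (h : ∀ m : M, ∃ n, n * m = 1) : IsBooleanTopos (Action Type M) := by
  refine ⟨inferInstance, Action.prodFunctor_isLeftAdjoint, Action.hasSubobjectClassifier,
    fun X S => ?_⟩
  -- If gx lay in S, so would x, by applying the left inverse of g: the set complement is invariant.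
  have hs : ∀ g, ∀ x ∈ (Action.carrier S)ᶜ, X.ρ g x ∈ (Action.carrier S)ᶜ := by
    intro g x hx hgx
    obtain ⟨n, hn⟩ := h g
    apply hx
    have h1 : X.ρ n (X.ρ g x) = x := by
      have : X.ρ (n * g) x = X.ρ n (X.ρ g x) := by rw [map_mul]; rfl
      rw [← this, hn, map_one]; rfl
    rw [← h1]
    exact Action.carrier_smul_mem S n hgx
  refine ⟨Subobject.mk (X.invariantSubsetι _ hs), fun U h1 h2 V => ?_, fun U h1 h2 => ?_⟩
  · apply Action.le_of_carrier_eq_empty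
    have h1' := Action.carrier_mono h1
    have h2' := Action.carrier_mono h2
    rw [Action.carrier_mk_invariantSubset] at h2'
    exact Set.eq_empty_of_forall_notMem fun x hx => h2' hx (h1' hx)
  · apply Action.eq_top_of_carrier_eq_univ
    have h1' := Action.carrier_mono h1
    have h2' := Action.carrier_mono h2
    rw [Action.carrier_mk_invariantSubset] at h2'
    refine Set.eq_univ_of_forall fun x => ?_
    by_cases hx : x ∈ Action.carrier S
    exacts [h1' hx, h2' hx]

/-- A monoid whose actions form a boolean topos is a group. -/
theorem exists_left_inv_of_isBooleanTopos (h : IsBooleanTopos (Action Type M)) (m : M) :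
    ∃ n, n * m = 1 := by
  obtain ⟨_, -, -, h⟩ := h
  let X : Action Type M := Action.ofMulAction M M
  -- The left ideal Mm; the goal amounts to 1 ∈ Mm.
  let s : Set X.V := {x | ∃ n : M, n * m = x}
  have hs : ∀ g, ∀ x ∈ s, X.ρ g x ∈ s := by
    rintro g _ ⟨n, rfl⟩
    exact ⟨g * n, mul_assoc g n m⟩
  obtain ⟨S', h1, h2⟩ := h X (Subobject.mk (X.invariantSubsetι s hs))
  have hinv : ∀ g : M, ∀ x ∈ s ∪ Action.carrier S', X.ρ g x ∈ s ∪ Action.carrier S' := by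
    rintro g x (hx | hx)
    exacts [Or.inl (hs g x hx), Or.inr (Action.carrier_smul_mem S' g hx)]
  have le_of : ∀ (S : Subobject X) (t : Set X.V) (ht : ∀ g, ∀ x ∈ t, X.ρ g x ∈ t),
      Action.carrier S ⊆ t → S ≤ Subobject.mk (X.invariantSubsetι t ht) := by
    intro S t ht hSt
    refine Subobject.le_mk_of_comm ⟨TypeCat.ofHom fun x => (⟨S.arrow.hom x, hSt ⟨x, rfl⟩⟩ : t),
      fun g => ?_⟩ ?_
    · ext x
      exact Subtype.ext (Action.map_smul_apply S.arrow g x)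
    · ext x
      rfl
  -- Mm ∪ S' is an invariant subset above both subobjects, so it is everything and contains 1.
  have htop := h2 (Subobject.mk (X.invariantSubsetι _ hinv))
    (le_of _ _ _ ((Action.carrier_mk_invariantSubset X s hs).le.trans Set.subset_union_left))
    (le_of _ _ _ Set.subset_union_right)
  have hone : (1 : M) ∈ s ∪ Action.carrier S' := by
    have h3 := Action.carrier_mk_invariantSubset X _ hinv
    rw [htop, Subobject.top_eq_id, Action.carrier_mk] at h3
    rw [← h3]
    exact ⟨(1 : M), rfl⟩
  rcases hone with hone | hone
  · exact hone
  -- An invariant subset containing 1 is all of M. Then Mm lies below both itself and S', so it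
  -- would be empty, yet it contains m.
  · have hS' : S' = ⊤ := by
      refine Action.eq_top_of_carrier_eq_univ (Set.eq_univ_of_forall fun x => ?_)
      have := Action.carrier_smul_mem S' x hone
      rwa [show X.ρ x (1 : M) = x from mul_one (M := M) x] at this
    have hbot := Action.carrier_mono (h1 _ le_rfl (hS' ▸ le_top)
      (Subobject.mk (X.invariantSubsetι ∅ fun _ _ hx => hx.elim)))
    rw [Action.carrier_mk_invariantSubset, Action.carrier_mk_invariantSubset] at hbot
    exact (hbot (show m ∈ s from ⟨1, one_mul m⟩)).elim

end BooleanTopos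

/-! ### Frobenius' theorem on real division algebras. -/

section Frobenius

variable {D : Type*} [Ring D] [Algebra ℝ D]

/-- Completing the square in a finite dimensional real division algebra. -/
theorem exists_sub_mul_self_eq_neg_sq [IsDomain D] [Module.Finite ℝ D] (x : D) :
    ∃ r s : ℝ, (x - r • 1) * (x - r • 1) = -(s ^ 2) • (1 : D) := by
  have hint : IsIntegral ℝ x := Algebra.IsIntegral.isIntegral x
  -- Irreducible real polynomials have degree at most two, so x satisfies c₀ + c₁x + c₂x² = 0 with
  -- not all coefficients zero.
  have hdeg := (minpoly.irreducible hint).natDegree_le_two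
  have hne := minpoly.ne_zero hint
  have h := minpoly.aeval ℝ x
  rw [Polynomial.aeval_eq_sum_range' (Nat.lt_succ_of_le hdeg)] at h
  simp only [Finset.sum_range_succ, Finset.sum_range_zero, pow_zero, pow_one, zero_add] at h
  generalize hc0 : (minpoly ℝ x).coeff 0 = c₀ at h
  generalize hc1 : (minpoly ℝ x).coeff 1 = c₁ at h
  generalize hc2 : (minpoly ℝ x).coeff 2 = c₂ at h
  have key : ∀ r : ℝ, x = r • 1 → ∃ r s : ℝ, (x - r • 1) * (x - r • 1) = -(s ^ 2) • (1 : D) :=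
    fun r hr => ⟨r, 0, by simp [hr]⟩
  by_cases h2 : c₂ = 0
  · subst h2
    by_cases h1 : c₁ = 0
    · subst h1
      rw [zero_smul, zero_smul, add_zero, add_zero] at h
      have h0 : c₀ = 0 := (smul_eq_zero.1 h).resolve_right one_ne_zero
      refine absurd (Polynomial.ext fun n => ?_) hne
      rcases n with _ | _ | _ | n
      · simp [hc0, h0]
      · simp [hc1]
      · simp [hc2]
      · exact Polynomial.coeff_eq_zero_of_natDegree_lt (by omega)
    · refine key (-c₀ / c₁) ?_
      have : c₁ • x = -(c₀ • (1 : D)) := by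
        rw [zero_smul, add_zero] at h
        exact eq_neg_of_add_eq_zero_right h
      rw [← inv_smul_smul₀ h1 x, this]
      module
  · have hsq : x * x = (-c₁ / c₂) • x + (-c₀ / c₂) • (1 : D) := by
      have : c₂ • (x * x) = -(c₀ • (1 : D) + c₁ • x) := by
        rw [← sq]; exact eq_neg_of_add_eq_zero_right h
      rw [← inv_smul_smul₀ h2 (x * x), this]
      module
    generalize -c₁ / c₂ = p at hsq
    generalize -c₀ / c₂ = q at hsq
    have hsq' : (x - (p / 2) • 1) * (x - (p / 2) • 1) = (p ^ 2 / 4 + q) • (1 : D) := by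
      simp only [sub_mul, mul_sub, smul_mul_assoc, mul_smul_comm, mul_one, one_mul, hsq]
      module
    -- A nonnegative discriminant factors the quadratic into real linear factors, so x is scalar and
    -- s = 0 works; a negative one is already -s².
    rcases le_total 0 (p ^ 2 / 4 + q) with hd | hd
    · set t := √(p ^ 2 / 4 + q)
      have ht : p ^ 2 / 4 + q = t * t := (Real.mul_self_sqrt hd).symm
      have : (x - (p / 2 + t) • 1) * (x - (p / 2 - t) • 1) = (0 : D) := by
        simp only [sub_mul, mul_sub, smul_mul_assoc, mul_smul_comm, mul_one, one_mul, ht] at hsq' ⊢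
        linear_combination (norm := module) hsq'
      rcases mul_eq_zero.1 this with h | h
      exacts [key _ (sub_eq_zero.1 h), key _ (sub_eq_zero.1 h)]
    · refine ⟨p / 2, √(-(p ^ 2 / 4 + q)), ?_⟩
      rw [hsq', Real.sq_sqrt (by linarith), neg_neg]

/-- Frobenius' theorem. -/
theorem finrank_le_two_or_nonempty_quaternion_algEquiv [IsDomain D] [Module.Finite ℝ D] :
    Module.finrank ℝ D ≤ 2 ∨ Nonempty (D ≃ₐ[ℝ] Quaternion ℝ) := by
  by_cases hreal : ∀ x : D, ∃ r : ℝ, x = r • 1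
  · left
    refine (finrank_le_one (1 : D) fun x => ?_).trans one_le_two
    obtain ⟨r, hr⟩ := hreal x
    exact ⟨r, hr.symm⟩
  push Not at hreal
  have exists_unit : ∀ x : D, (∀ r : ℝ, x ≠ r • 1) →
      ∃ r s : ℝ, s ≠ 0 ∧ (s⁻¹ • (x - r • 1)) * (s⁻¹ • (x - r • 1)) = (-1 : D) := by
    intro x hx
    obtain ⟨r, s, h⟩ := exists_sub_mul_self_eq_neg_sq x
    have hs : s ≠ 0 := by
      rintro rfl
      have := mul_self_eq_zero.1 (h.trans (by simp))
      exact hx r (sub_eq_zero.1 this)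
    refine ⟨r, s, hs, ?_⟩
    rw [smul_mul_smul_comm, h, smul_smul]
    rw [show s⁻¹ * s⁻¹ * -s ^ 2 = -1 by field_simp, neg_one_smul]
  obtain ⟨i, hi⟩ : ∃ i : D, i * i = -1 := by
    obtain ⟨x, hx⟩ := hreal
    obtain ⟨r, s, -, h⟩ := exists_unit x hx
    exact ⟨_, h⟩
  -- The centralizer of i is ℝ + ℝi: when x commutes with i, (x - r)² + s² factors as (x - r - si)(x
  -- - r + si).
  have hcomm : ∀ x : D, i * x = x * i → ∃ a b : ℝ, x = a • 1 + b • i := by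
    intro x hx
    obtain ⟨r, s, h⟩ := exists_sub_mul_self_eq_neg_sq x
    have : (x - r • 1 - s • i) * (x - r • 1 + s • i) = 0 := by
      simp only [sub_mul, mul_sub, mul_add, smul_mul_assoc, mul_smul_comm, mul_one, one_mul, hi,
        hx] at h ⊢
      linear_combination (norm := module) h
    rcases mul_eq_zero.1 this with h | h
    · exact ⟨r, s, by linear_combination (norm := module) h⟩
    · exact ⟨r, -s, by linear_combination (norm := module) h⟩
  -- Conjugation by i is x ↦ -ixi, an involution; these are its invariant and anti-invariant parts,
  -- up to the factor 2.
  have hdecomp : ∀ x : D, i * (x - i * x * i) = (x - i * x * i) * i ∧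
      i * (x + i * x * i) = -((x + i * x * i) * i) := by
    intro x
    have h1 : i * (i * x * i) = -(x * i) := by
      rw [← mul_assoc, ← mul_assoc, hi]; noncomm_ring
    have h2 : i * x * i * i = -(i * x) := by rw [mul_assoc, hi]; noncomm_ring
    constructor
    · rw [mul_sub, sub_mul, h1, h2]; abel
    · rw [mul_add, add_mul, h1, h2]; abel
  have hhalf : ∀ x : D, x = (2⁻¹ : ℝ) • (x - i * x * i) + (2⁻¹ : ℝ) • (x + i * x * i) := by
    intro x
    module
  by_cases hanti : ∀ x : D, i * x = -(x * i) → x = 0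
  · left
    have : Module.finrank ℝ D ≤ Fintype.card (Fin 2) := by
      refine finrank_le_of_span_eq_top (v := ![1, i]) ?_
      rw [eq_top_iff]
      intro x _
      obtain ⟨a, b, hab⟩ := hcomm _ (hdecomp x).1
      rw [hhalf x, hanti _ (hdecomp x).2, hab]
      simp only [Matrix.range_cons, Matrix.range_empty, Set.union_empty, Set.singleton_union,
        Submodule.mem_span_pair]
      exact ⟨2⁻¹ * a, 2⁻¹ * b, by module⟩
    simpa using this
  right
  push Not at hanti
  obtain ⟨y, hy, hy0⟩ := hanti
  have htwo : (2 : ℝ) ≠ 0 := two_ne_zero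
  have hself : ∀ z : D, z = -z → z = 0 := by
    intro z hz
    have h : (2 : ℝ) • z = 0 := by
      rw [two_smul]; nth_rewrite 2 [hz]; exact add_neg_cancel z
    exact (smul_eq_zero.1 h).resolve_left htwo
  have hi0 : i ≠ 0 := by
    rintro rfl
    simp at hi
  obtain ⟨j, hj, hij⟩ : ∃ j : D, j * j = -1 ∧ i * j = -(j * i) := by
    obtain ⟨r, s, hs, h⟩ := exists_unit y (by
      rintro r rfl
      apply hy0
      have : (r • 1 : D) * i = 0 := hself _ (by simpa using hy)
      exact (mul_eq_zero.1 this).resolve_right hi0)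
    have hyy : i * (y * y) = (y * y) * i := by
      rw [← mul_assoc, hy, neg_mul, mul_assoc, hy, mul_neg, neg_neg, mul_assoc]
    -- The square of y - r is scalar and y² commutes with i, so in the commutator with i only a
    -- multiple of r·yi survives.
    have hr : r = 0 := by
      rw [smul_mul_smul_comm] at h
      have h' := congrArg (fun z => i * z - z * i) h
      simp only [sub_mul, mul_sub, smul_mul_assoc, mul_smul_comm, mul_one, one_mul, mul_neg,
        neg_mul, hyy, smul_sub, smul_smul] at h'
      rw [hy] at h'
      have h2 : (4 * (s⁻¹ * s⁻¹) * r) • (y * i) = 0 := by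
        linear_combination (norm := module) h'
      rcases smul_eq_zero.1 h2 with h2 | h2
      · have : s⁻¹ ≠ 0 := inv_ne_zero hs
        simpa [this] using h2
      · exact ((mul_ne_zero hy0 hi0) h2).elim
    subst hr
    rw [zero_smul, sub_zero] at h
    refine ⟨_, h, ?_⟩
    rw [mul_smul_comm, hy, smul_mul_assoc, smul_neg]
  let B : QuaternionAlgebra.Basis D (-1 : ℝ) 0 (-1) :=
    { i := i
      j := j
      k := i * j
      i_mul_i := by rw [hi]; simp
      j_mul_j := by rw [hj]; simp
      i_mul_j := rfl
      j_mul_i := by rw [hij]; simp }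
  let f : Quaternion ℝ →ₐ[ℝ] D := B.liftHom
  have hf : ∀ a b c d : ℝ, f ⟨a, b, c, d⟩ = a • 1 + b • i + c • j + d • (i * j) := by
    intro a b c d
    change algebraMap ℝ D a + b • i + c • j + d • (i * j) = _
    rw [Algebra.algebraMap_eq_smul_one]
  have hsurj : Function.Surjective f := by
    intro x
    obtain ⟨a, b, hab⟩ := hcomm _ (hdecomp x).1
    have hanti := (hdecomp x).2
    have hx := hhalf x
    generalize x + i * x * i = w at hanti hx
    -- Both w and j anticommute with i, so wj lies in the centralizer ℝ + ℝi, and w is recovered as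
    -- -(wj)j.
    obtain ⟨c, d, hcd⟩ := hcomm (w * j) (by
      rw [← mul_assoc, hanti, neg_mul, mul_assoc, hij, mul_neg, neg_neg, mul_assoc])
    have hcd' : w = -((c • 1 + d • i) * j) := by
      rw [← hcd, mul_assoc, hj, mul_neg, mul_one, neg_neg]
    refine ⟨⟨2⁻¹ * a, 2⁻¹ * b, -(2⁻¹ * c), -(2⁻¹ * d)⟩, ?_⟩
    rw [hf, hx, hcd', hab, add_mul, smul_mul_assoc, smul_mul_assoc, one_mul]
    module
  exact ⟨(AlgEquiv.ofBijective f ⟨f.toRingHom.injective, hsurj⟩).symm⟩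

end Frobenius

/-! ### The quaternions as the home paradigm. -/

section HomeParadigm

theorem mem_motorDomain_of_ne_zero {A : Type} [NonUnitalNonAssocRing A] {a : A} (ha : a ≠ 0) :
    a ∈ motorDomain A :=
  Subsemigroup.subset_closure ha

theorem mem_motorDomain_iff {A : Type} [NonUnitalNonAssocRing A] [NoZeroDivisors A] {a : A} :
    a ∈ motorDomain A ↔ a ≠ 0 := by
  refine ⟨fun h => ?_, mem_motorDomain_of_ne_zero⟩
  induction h using Subsemigroup.closure_induction with
  | mem x hx => exact hx
  | mul x y _ _ hx hy => exact mul_ne_zero hx hy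

theorem isConsistentParadigm_quaternion : IsConsistentParadigm (Quaternion ℝ) := by
  have hM : MotorIsMonoid (Quaternion ℝ) :=
    ⟨fun x y z => Subtype.ext (mul_assoc _ _ _),
      ⟨⟨1, mem_motorDomain_of_ne_zero one_ne_zero⟩, fun x =>
        ⟨Subtype.ext (one_mul _), Subtype.ext (mul_one _)⟩⟩⟩
  refine ⟨⟨inferInstance, hM⟩, hM, ?_⟩
  refine @isBooleanTopos_action (motorDomain (Quaternion ℝ)) hM.monoid fun m => ?_
  have hm : m.1 ≠ 0 := mem_motorDomain_iff.1 m.2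
  -- The unit of `hM.monoid` comes from choice and has to be identified with 1.
  have hone : (hM.exists_one.choose : Quaternion ℝ) = 1 := by
    have h := congrArg Subtype.val
      (hM.exists_one.choose_spec ⟨1, mem_motorDomain_of_ne_zero one_ne_zero⟩).1
    simpa using h
  exact ⟨⟨m.1⁻¹, mem_motorDomain_of_ne_zero (inv_ne_zero hm)⟩,
    Subtype.ext ((inv_mul_cancel₀ hm).trans hone.symm)⟩

variable {A : Type} [NonUnitalNonAssocRing A] [Module ℝ A] [IsScalarTower ℝ A A]
  [SMulCommClass ℝ A A]

/-- Consistent paradigms are division algebras. -/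
theorem IsConsistentParadigm.exists_one (hA : IsConsistentParadigm A) :
    (∀ x y z : A, x * y * z = x * (y * z)) ∧ ∃ e : A, e ≠ 0 ∧ (∀ x, e * x = x ∧ x * e = x) ∧
      ∀ x, x ≠ 0 → ∃ y, y * x = e := by
  obtain ⟨-, hM, htop⟩ := hA
  have hinv := @exists_left_inv_of_isBooleanTopos (motorDomain A) hM.monoid htop
  obtain ⟨e, he⟩ : ∃ e : motorDomain A, (∀ x : motorDomain A, e * x = x ∧ x * e = x) ∧
      ∀ m : motorDomain A, ∃ n, n * m = e :=
    ⟨hM.exists_one.choose, hM.exists_one.choose_spec, hinv⟩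
  -- The zero algebra has an empty motor domain, which contains no identity.
  obtain ⟨a, ha⟩ : ∃ a : A, a ≠ 0 := by
    by_contra! h
    have hmem := e.2
    have hempty : {a : A | a ≠ 0} = ∅ := Set.eq_empty_of_forall_notMem fun x hx => hx (h x)
    change e.1 ∈ Subsemigroup.closure {a : A | a ≠ 0} at hmem
    rw [hempty, Subsemigroup.closure_empty] at hmem
    exact hmem
  have heval : ∀ x : A, x ≠ 0 → e.1 * x = x ∧ x * e.1 = x := fun x hx =>
    ⟨congrArg Subtype.val (he.1 ⟨x, mem_motorDomain_of_ne_zero hx⟩).1,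
      congrArg Subtype.val (he.1 ⟨x, mem_motorDomain_of_ne_zero hx⟩).2⟩
  refine ⟨fun x y z => ?_, e.1, ?_, fun x => ?_, fun x hx => ?_⟩
  · by_cases hx : x = 0
    · simp [hx]
    by_cases hy : y = 0
    · simp [hy]
    by_cases hz : z = 0
    · simp [hz]
    exact congrArg Subtype.val (hM.assoc ⟨x, mem_motorDomain_of_ne_zero hx⟩
      ⟨y, mem_motorDomain_of_ne_zero hy⟩ ⟨z, mem_motorDomain_of_ne_zero hz⟩)
  · intro h0
    have := (heval a ha).1
    rw [h0, zero_mul] at this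
    exact ha this.symm
  · by_cases hx : x = 0
    · simp [hx]
    · exact heval x hx
  · obtain ⟨n, hn⟩ := he.2 ⟨x, mem_motorDomain_of_ne_zero hx⟩
    exact ⟨n.1, congrArg Subtype.val hn⟩

/-- The laws of the motor domain extend to 0, so they make the whole algebra a division ring over ℝ
to which Frobenius' theorem applies. -/
theorem IsConsistentParadigm.finrank_le_two_or (hA : IsConsistentParadigm A) :
    Module.finrank ℝ A ≤ 2 ∨
      ∃ φ : A ≃ₗ[ℝ] Quaternion ℝ, ∀ x y, φ (x * y) = φ x * φ y := by
  obtain ⟨hassoc, e, he0, he, hinv⟩ := hA.exists_one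
  let _ : Ring A :=
    { ‹NonUnitalNonAssocRing A› with
      mul_assoc := hassoc
      one := e
      one_mul := fun x => (he x).1
      mul_one := fun x => (he x).2 }
  let _ : Algebra ℝ A := Algebra.ofModule smul_mul_assoc mul_smul_comm
  have : Nontrivial A := ⟨e, 0, he0⟩
  have : NoZeroDivisors A := ⟨fun {x y} h => by
    by_cases hx : x = 0
    · exact Or.inl hx
    obtain ⟨z, hz⟩ := hinv x hx
    right
    rw [← (he y).1, ← hz, mul_assoc, h, mul_zero]⟩
  have : IsDomain A := NoZeroDivisors.to_isDomain A
  have : Module.Finite ℝ A := hA.1.1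
  refine finrank_le_two_or_nonempty_quaternion_algEquiv.imp_right ?_
  rintro ⟨φ⟩
  exact ⟨φ.toLinearEquiv, fun x y => map_mul φ x y⟩

theorem finrank_quaternion_real : Module.finrank ℝ (Quaternion ℝ) = 4 :=
  Quaternion.finrank_eq_four

theorem isHomeParadigm_quaternion : IsHomeParadigm (Quaternion ℝ) := by
  refine ⟨isConsistentParadigm_quaternion, fun B _ _ _ _ hB => ?_⟩
  rcases hB.finrank_le_two_or with h | ⟨φ, -⟩
  · rw [finrank_quaternion_real]; omega
  · exact φ.finrank_eq.le

theorem IsHomeParadigm.exists_linearEquiv_quaternion (hA : IsHomeParadigm A) :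
    ∃ φ : A ≃ₗ[ℝ] Quaternion ℝ, ∀ x y, φ (x * y) = φ x * φ y := by
  refine hA.1.finrank_le_two_or.resolve_left fun h => ?_
  have := hA.2 (Quaternion ℝ) isConsistentParadigm_quaternion
  rw [finrank_quaternion_real] at this
  omega

end HomeParadigm

/-! ### Structure field and metric under algebra isomorphisms. -/

section Transport

variable {A B : Type} [NonUnitalNonAssocRing A] [Module ℝ A]
  [NonUnitalNonAssocRing B] [Module ℝ B]

theorem LinearEquiv.symm_map_mul_of_map_mul (φ : A ≃ₗ[ℝ] B) (hφ : ∀ x y, φ (x * y) = φ x * φ y)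
    (x y : B) : φ.symm (x * y) = φ.symm x * φ.symm y :=
  φ.injective (by simp [hφ])

theorem LinearEquiv.map_mem_perceptionDomain (φ : A ≃ₗ[ℝ] B)
    (hφ : ∀ x y, φ (x * y) = φ x * φ y) {a : A} (ha : a ∈ perceptionDomain A) :
    φ a ∈ perceptionDomain B := by
  obtain ⟨e, b, he, h1, h2⟩ := ha
  refine ⟨φ e, φ b, fun x => ?_, by rw [← hφ, h1], by rw [← hφ, h2]⟩
  obtain ⟨x, rfl⟩ := φ.surjective x
  rw [← hφ, ← hφ, (he x).1, (he x).2]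
  exact ⟨rfl, rfl⟩

theorem LinearEquiv.map_mem_perceptionDomain_iff (φ : A ≃ₗ[ℝ] B)
    (hφ : ∀ x y, φ (x * y) = φ x * φ y) {a : A} :
    φ a ∈ perceptionDomain B ↔ a ∈ perceptionDomain A := by
  refine ⟨fun h => ?_, φ.map_mem_perceptionDomain hφ⟩
  simpa using φ.symm.map_mem_perceptionDomain (φ.symm_map_mul_of_map_mul hφ) h

theorem perceptionDomain_quaternion : perceptionDomain (Quaternion ℝ) = {0}ᶜ := by
  ext a
  constructor
  · rintro ⟨e, b, he, h1, -⟩ (rfl : a = 0)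
    have h2 := (he 1).1
    rw [← h1, zero_mul, zero_mul] at h2
    exact zero_ne_one h2
  · intro ha
    exact ⟨1, a⁻¹, fun x => ⟨one_mul x, mul_one x⟩, mul_inv_cancel₀ ha, inv_mul_cancel₀ ha⟩

theorem leftDiv_quaternion {a : Quaternion ℝ} (ha : a ≠ 0) (x : Quaternion ℝ) :
    leftDiv a x = a⁻¹ * x := by
  have h : ∃ u, a * u = x := ⟨a⁻¹ * x, mul_inv_cancel_left₀ ha x⟩
  rw [leftDiv, dif_pos h]
  exact (eq_inv_mul_iff_mul_eq₀ ha).2 h.choose_spec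

/-- For x = au and y = av one has a(uv) = (au)a⁻¹(av), so neither u nor v needs to be named. -/
theorem structureField_quaternion {a : Quaternion ℝ} (ha : a ≠ 0) (x y : Quaternion ℝ) :
    structureField a x y = x * (a⁻¹ * y) := by
  rw [structureField, leftDiv_quaternion ha, leftDiv_quaternion ha, ← mul_assoc,
    mul_inv_cancel_left₀ ha]

theorem LinearEquiv.map_structureField (φ : A ≃ₗ[ℝ] Quaternion ℝ)
    (hφ : ∀ x y, φ (x * y) = φ x * φ y) {a : A} (ha : φ a ≠ 0) (x y : A) :
    φ (structureField a x y) = structureField (φ a) (φ x) (φ y) := by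
  have key : ∀ x, φ (leftDiv a x) = leftDiv (φ a) (φ x) := by
    intro x
    have h : ∃ u, a * u = x :=
      ⟨φ.symm ((φ a)⁻¹ * φ x), φ.injective (by simp [hφ, mul_inv_cancel_left₀ ha])⟩
    rw [leftDiv_quaternion ha, leftDiv, dif_pos h, eq_inv_mul_iff_mul_eq₀ ha, ← hφ, h.choose_spec]
  rw [structureField, structureField, hφ, hφ, key, key]

/-- A line derivative involves only the linear structure, so both sides differentiate the same real
function; no topology on A is needed. -/
theorem LinearEquiv.principalMetric_comp_symm (φ : A ≃ₗ[ℝ] Quaternion ℝ)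
    (hφ : ∀ x y, φ (x * y) = φ x * φ y) (T : A → ℝ) {a : A} (ha : φ a ≠ 0) (x y : A) :
    principalMetric (T ∘ φ.symm) (φ a) (φ x) (φ y) = principalMetric T a x y := by
  rw [principalMetric, principalMetric, ← φ.map_structureField hφ ha, lineDeriv, lineDeriv]
  simp

theorem GeneratesPrincipalMetric.comp_symm {k : ℕ∞} {T : A → ℝ}
    (hT : GeneratesPrincipalMetric k A T) (φ : A ≃ₗ[ℝ] Quaternion ℝ)
    (hφ : ∀ x y, φ (x * y) = φ x * φ y) :
    GeneratesPrincipalMetric k (Quaternion ℝ) (T ∘ φ.symm) := by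
  obtain ⟨⟨n, b, hb⟩, hT⟩ := hT
  refine ⟨⟨n, b.map φ, ?_⟩, fun a ha => ?_⟩
  · have h : ∀ c, (b.map φ).equivFun.symm c = φ (b.equivFun.symm c) := by
      intro c
      simp [Module.Basis.equivFun_symm_apply]
    simpa only [h, Function.comp_apply, φ.symm_apply_apply, φ.map_mem_perceptionDomain_iff hφ]
      using hb
  · obtain ⟨a, rfl⟩ := φ.surjective a
    have ha0 : φ a ≠ 0 := by rwa [perceptionDomain_quaternion] at ha
    rw [φ.map_mem_perceptionDomain_iff hφ] at ha
    obtain ⟨h1, h2⟩ := hT a ha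
    refine ⟨φ.surjective.forall₂.2 fun x y => ?_, φ.surjective.forall.2 fun x hx => ?_⟩
    · rw [φ.principalMetric_comp_symm hφ T ha0, φ.principalMetric_comp_symm hφ T ha0, h1]
    · rw [h2 x fun y => ?_, map_zero]
      rw [← φ.principalMetric_comp_symm hφ T ha0, hx]

end Transport

/-! ### Reduction of cosmologies to the quaternions. -/

section Cosmology

theorem isPartialOrder_temporalOrder {A : Type} (T : A → ℝ) :
    IsPartialOrder A (temporalOrder T) where
  refl a := Or.inr rfl
  trans a b c := by
    rintro (h | rfl) (h' | rfl)
    exacts [Or.inl (h.trans h'), Or.inl h, Or.inl h', Or.inr rfl]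
  antisymm a b := by
    rintro (h | rfl) (h' | h')
    exacts [(lt_asymm h h').elim, h'.symm, rfl, rfl]

/-- The temporal order is always a partial order and the quaternions are a home paradigm, so the
metric condition is the only real constraint. -/
theorem isCosmology_quaternion_iff {k : ℕ∞} {T : Quaternion ℝ → ℝ} :
    IsCosmology k (Quaternion ℝ) (temporalOrder T) T ↔
      GeneratesPrincipalMetric k (Quaternion ℝ) T :=
  ⟨fun h => h.1.2, fun h => ⟨⟨⟨isConsistentParadigm_quaternion.1, isPartialOrder_temporalOrder T,
    fun _ _ => Iff.rfl⟩, h⟩, Quaternion ℝ, inferInstance, inferInstance, inferInstance,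
    inferInstance, isHomeParadigm_quaternion, LinearEquiv.refl ℝ _, fun _ _ => rfl⟩⟩

theorem IsCosmology.exists_linearEquiv_quaternion {k : ℕ∞} {A : Type} [NonUnitalNonAssocRing A]
    [Module ℝ A] [IsScalarTower ℝ A A] [SMulCommClass ℝ A A] {R : A → A → Prop} {T : A → ℝ}
    (h : IsCosmology k A R T) :
    R = temporalOrder T ∧ ∃ φ : A ≃ₗ[ℝ] Quaternion ℝ, (∀ x y, φ (x * y) = φ x * φ y) ∧
      IsCosmology k (Quaternion ℝ) (fun x y => R (φ.symm x) (φ.symm y)) (T ∘ φ.symm) := by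
  obtain ⟨⟨⟨-, -, hR⟩, hT⟩, B, _, _, _, _, hB, ψ, hψ⟩ := h
  have hR' : R = temporalOrder T := funext fun a => funext fun b => propext (hR a b)
  refine ⟨hR', ?_⟩
  obtain ⟨χ, hχ⟩ := hB.exists_linearEquiv_quaternion
  have hφ : ∀ x y, (ψ.trans χ) (x * y) = (ψ.trans χ) x * (ψ.trans χ) y := fun x y => by
    simp [hψ, hχ]
  refine ⟨ψ.trans χ, hφ, ?_⟩
  convert isCosmology_quaternion_iff.2 (hT.comp_symm _ hφ) using 1
  ext x y
  simp [hR', temporalOrder]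

end Cosmology

/-! ### Algebra endomorphisms of the quaternions are isometries. -/

section QuaternionHom

namespace Quaternion

/-- The quaternion with given coordinates. -/
def ofCoords (a b c d : ℝ) : Quaternion ℝ := ⟨a, b, c, d⟩

variable (a b c d : ℝ)

@[simp] theorem re_ofCoords : (ofCoords a b c d).re = a := rfl
@[simp] theorem imI_ofCoords : (ofCoords a b c d).imI = b := rfl
@[simp] theorem imJ_ofCoords : (ofCoords a b c d).imJ = c := rfl
@[simp] theorem imK_ofCoords : (ofCoords a b c d).imK = d := rfl

/-- The imaginary part of x² is twice the real part times the imaginary part of x. A nonzero real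
part would thus make x real, with a nonnegative square. -/
theorem re_eq_zero_of_mul_self_eq_neg_one {x : Quaternion ℝ} (hx : x * x = -1) : x.re = 0 := by
  have h0 := congrArg QuaternionAlgebra.re hx
  have h1 := congrArg QuaternionAlgebra.imI hx
  have h2 := congrArg QuaternionAlgebra.imJ hx
  have h3 := congrArg QuaternionAlgebra.imK hx
  simp at h0 h1 h2 h3
  by_contra hr
  have h1' : x.imI = 0 := by
    have : x.re * x.imI = 0 := by linarith
    simpa [hr] using this
  have h2' : x.imJ = 0 := by
    have : x.re * x.imJ = 0 := by linarith
    simpa [hr] using this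
  have h3' : x.imK = 0 := by
    have : x.re * x.imK = 0 := by linarith
    simpa [hr] using this
  rw [h1', h2', h3'] at h0
  nlinarith [sq_nonneg x.re]

theorem eq_ofCoords (x : Quaternion ℝ) : x = ofCoords x.re x.imI x.imJ x.imK := rfl

theorem ofCoords_eq_smul : ofCoords a b c d =
    a • 1 + b • ofCoords 0 1 0 0 + c • ofCoords 0 0 1 0 + d • ofCoords 0 0 0 1 := by
  ext <;> simp

/-- The images of i, j, k square to -1 and are therefore imaginary. Compatibility with conjugation,
inner product and norm follows from this. -/
theorem re_algHom (Ψ : Quaternion ℝ →ₐ[ℝ] Quaternion ℝ) (x : Quaternion ℝ) :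
    (Ψ x).re = x.re := by
  have key : ∀ y : Quaternion ℝ, y * y = -1 → (Ψ y).re = 0 := fun y hy =>
    re_eq_zero_of_mul_self_eq_neg_one (by rw [← map_mul, hy, map_neg, map_one])
  have h1 := key (ofCoords 0 1 0 0) (by ext <;> simp)
  have h2 := key (ofCoords 0 0 1 0) (by ext <;> simp)
  have h3 := key (ofCoords 0 0 0 1) (by ext <;> simp)
  rw [eq_ofCoords x, ofCoords_eq_smul]
  simp [h1, h2, h3]

theorem star_algHom (Ψ : Quaternion ℝ →ₐ[ℝ] Quaternion ℝ) (x : Quaternion ℝ) :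
    star (Ψ x) = Ψ (star x) := by
  rw [star_eq_two_re_sub, star_eq_two_re_sub, re_algHom, map_sub]
  congr 1
  exact (Ψ.commutes _).symm

theorem inner_algHom (Ψ : Quaternion ℝ →ₐ[ℝ] Quaternion ℝ) (x y : Quaternion ℝ) :
    inner ℝ (Ψ x) (Ψ y) = inner ℝ x y := by
  rw [inner_def, inner_def, star_algHom, ← map_mul, re_algHom]

theorem norm_algHom (Ψ : Quaternion ℝ →ₐ[ℝ] Quaternion ℝ) (x : Quaternion ℝ) :
    ‖Ψ x‖ = ‖x‖ := by
  rw [norm_eq_sqrt_real_inner, inner_algHom, ← norm_eq_sqrt_real_inner]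

/-- The endomorphism of the quaternions with prescribed values on the imaginary units. -/
theorem exists_algHom {i j k : Quaternion ℝ} (hi : i * i = -1) (hj : j * j = -1) (hij : i * j = k)
    (hji : j * i = -k) : ∃ Ψ : Quaternion ℝ →ₐ[ℝ] Quaternion ℝ, ∀ a b c d : ℝ,
      Ψ (ofCoords a b c d) = a • 1 + b • i + c • j + d • k := by
  let B : QuaternionAlgebra.Basis (Quaternion ℝ) (-1 : ℝ) 0 (-1) :=
    { i := i
      j := j
      k := k
      i_mul_i := by rw [hi]; simp
      j_mul_j := by rw [hj]; simp
      i_mul_j := hij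
      j_mul_i := by rw [hji]; simp }
  refine ⟨B.liftHom, fun a b c d => ?_⟩
  change algebraMap ℝ (Quaternion ℝ) a + b • i + c • j + d • k = _
  rw [Algebra.algebraMap_eq_smul_one]

end Quaternion

open Quaternion

/-- Coordinates in a canonical basis become standard coordinates under an endomorphism, so later
identities need checking only for 1, i, j, k. -/
theorem IsCanonicalBasis.exists_algHom {b : Module.Basis (Fin 4) ℝ (Quaternion ℝ)}
    (hb : IsCanonicalBasis b) : ∃ Ψ : Quaternion ℝ →ₐ[ℝ] Quaternion ℝ, ∀ c₀ c₁ c₂ c₃ : ℝ,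
      Ψ (ofCoords c₀ c₁ c₂ c₃) = c₀ • b 0 + c₁ • b 1 + c₂ • b 2 + c₃ • b 3 := by
  have h00 : b 0 = 1 := by
    have h := hb 0 0
    simp [canonicalConstants, Fin.sum_univ_four] at h
    exact (mul_eq_left₀ (b.ne_zero 0)).1 h
  have h11 := hb 1 1
  have h22 := hb 2 2
  have h12 := hb 1 2
  have h21 := hb 2 1
  simp [canonicalConstants, Fin.sum_univ_four, h00] at h11 h22 h12 h21
  rw [h00]
  exact Quaternion.exists_algHom h11 h22 h12 h21

end QuaternionHom

/-! ### Spherical coordinates and the structure field. -/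

section Spherical

open Quaternion

variable {b : Module.Basis (Fin 4) ℝ (Quaternion ℝ)}

theorem hasDerivAt_smul_four {f₀ f₁ f₂ f₃ : ℝ → ℝ} {f₀' f₁' f₂' f₃' t : ℝ}
    (h₀ : HasDerivAt f₀ f₀' t) (h₁ : HasDerivAt f₁ f₁' t) (h₂ : HasDerivAt f₂ f₂' t)
    (h₃ : HasDerivAt f₃ f₃' t) (v : Fin 4 → Quaternion ℝ) :
    HasDerivAt (fun s => f₀ s • v 0 + f₁ s • v 1 + f₂ s • v 2 + f₃ s • v 3)
      (f₀' • v 0 + f₁' • v 1 + f₂' • v 2 + f₃' • v 3) t :=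
  (((h₀.smul_const _).add (h₁.smul_const _)).add (h₂.smul_const _)).add (h₃.smul_const _)

theorem hasDerivAt_sphericalPoint_zero {R : ℝ → ℝ} {R' : ℝ} (q : Fin 4 → ℝ)
    (hR : HasDerivAt R R' (q 0)) :
    HasDerivAt (fun s => sphericalPoint b R (Function.update q 0 s))
      ((R' * Real.cos (q 1)) • b 0 +
        (R' * Real.sin (q 1) * Real.sin (q 2) * Real.cos (q 3)) • b 1 +
        (R' * Real.sin (q 1) * Real.sin (q 2) * Real.sin (q 3)) • b 2 +
        (R' * Real.sin (q 1) * Real.cos (q 2)) • b 3) (q 0) := by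
  simp only [sphericalPoint, Function.update_self, Function.update_of_ne, ne_eq, Fin.reduceEq,
    not_false_eq_true]
  exact hasDerivAt_smul_four (hR.mul_const _) (((hR.mul_const _).mul_const _).mul_const _)
    (((hR.mul_const _).mul_const _).mul_const _) ((hR.mul_const _).mul_const _) b

theorem sphericalFrame_one (R : ℝ → ℝ) (q : Fin 4 → ℝ) :
    sphericalFrame b R q 1 = (R (q 0) * -Real.sin (q 1)) • b 0 +
      (R (q 0) * Real.cos (q 1) * Real.sin (q 2) * Real.cos (q 3)) • b 1 +
      (R (q 0) * Real.cos (q 1) * Real.sin (q 2) * Real.sin (q 3)) • b 2 +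
      (R (q 0) * Real.cos (q 1) * Real.cos (q 2)) • b 3 := by
  have hc := Real.hasDerivAt_cos (q 1)
  have hs := Real.hasDerivAt_sin (q 1)
  simp only [sphericalFrame, sphericalPoint, Function.update_self, Function.update_of_ne, ne_eq,
    Fin.reduceEq, not_false_eq_true]
  exact (hasDerivAt_smul_four (hc.const_mul _) (((hs.const_mul _).mul_const _).mul_const _)
    (((hs.const_mul _).mul_const _).mul_const _) ((hs.const_mul _).mul_const _) b).deriv

theorem sphericalFrame_two (R : ℝ → ℝ) (q : Fin 4 → ℝ) :
    sphericalFrame b R q 2 = (0 : ℝ) • b 0 +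
      (R (q 0) * Real.sin (q 1) * Real.cos (q 2) * Real.cos (q 3)) • b 1 +
      (R (q 0) * Real.sin (q 1) * Real.cos (q 2) * Real.sin (q 3)) • b 2 +
      (R (q 0) * Real.sin (q 1) * -Real.sin (q 2)) • b 3 := by
  have hc := Real.hasDerivAt_cos (q 2)
  have hs := Real.hasDerivAt_sin (q 2)
  simp only [sphericalFrame, sphericalPoint, Function.update_self, Function.update_of_ne, ne_eq,
    Fin.reduceEq, not_false_eq_true]
  exact (hasDerivAt_smul_four (hasDerivAt_const _ _) ((hs.const_mul _).mul_const _)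
    ((hs.const_mul _).mul_const _) (hc.const_mul _) b).deriv

theorem sphericalFrame_three (R : ℝ → ℝ) (q : Fin 4 → ℝ) :
    sphericalFrame b R q 3 = (0 : ℝ) • b 0 +
      (R (q 0) * Real.sin (q 1) * Real.sin (q 2) * -Real.sin (q 3)) • b 1 +
      (R (q 0) * Real.sin (q 1) * Real.sin (q 2) * Real.cos (q 3)) • b 2 + (0 : ℝ) • b 3 := by
  have hc := Real.hasDerivAt_cos (q 3)
  have hs := Real.hasDerivAt_sin (q 3)
  simp only [sphericalFrame, sphericalPoint, Function.update_self, Function.update_of_ne, ne_eq,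
    Fin.reduceEq, not_false_eq_true]
  exact (hasDerivAt_smul_four (hasDerivAt_const _ _) (hc.const_mul _)
    (hs.const_mul _) (hasDerivAt_const _ _) b).deriv

/-- Coordinates of the spherical frame in a basis adapted to the direction of the point. -/
theorem IsCanonicalBasis.exists_sphericalHom (hb : IsCanonicalBasis b) (q : Fin 4 → ℝ) :
    ∃ Ψ : Quaternion ℝ →ₐ[ℝ] Quaternion ℝ, ∀ R : ℝ → ℝ,
      sphericalPoint b R q =
        Ψ (ofCoords (R (q 0) * Real.cos (q 1)) (R (q 0) * Real.sin (q 1)) 0 0) ∧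
      (∀ R', HasDerivAt R R' (q 0) →
        sphericalFrame b R q 0 = Ψ (ofCoords (R' * Real.cos (q 1)) (R' * Real.sin (q 1)) 0 0)) ∧
      sphericalFrame b R q 1 =
        Ψ (ofCoords (-(R (q 0) * Real.sin (q 1))) (R (q 0) * Real.cos (q 1)) 0 0) ∧
      sphericalFrame b R q 2 = Ψ (ofCoords 0 0 (R (q 0) * Real.sin (q 1)) 0) ∧
      sphericalFrame b R q 3 = Ψ (ofCoords 0 0 0 (R (q 0) * Real.sin (q 1) * Real.sin (q 2))) := by
  obtain ⟨Φ, hΦ⟩ := hb.exists_algHom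
  have h2 := Real.sin_sq_add_cos_sq (q 2)
  have h3 := Real.sin_sq_add_cos_sq (q 3)
  set s := Real.sin (q 2)
  set c := Real.cos (q 2)
  set s' := Real.sin (q 3)
  set c' := Real.cos (q 3)
  -- X sends i, j, k to the unit direction with angles θ, φ and to its normalised θ- and
  -- φ-derivatives, a positively oriented orthonormal triple.
  obtain ⟨X, hX⟩ := Quaternion.exists_algHom (i := ofCoords 0 (s * c') (s * s') c)
    (j := ofCoords 0 (c * c') (c * s') (-s)) (k := ofCoords 0 (-s') c' 0)
    (by
      ext <;> simp
      · linear_combination (-s ^ 2) * h3 - h2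
      all_goals ring)
    (by
      ext <;> simp
      · linear_combination (-c ^ 2) * h3 - h2
      all_goals ring)
    (by
      ext <;> simp
      · linear_combination -s * c * h3
      · linear_combination (-s') * h2
      · linear_combination c' * h2
      · ring)
    (by
      ext <;> simp
      · linear_combination -s * c * h3
      · linear_combination s' * h2
      · linear_combination (-c') * h2
      · ring)
  refine ⟨Φ.comp X, fun R => ⟨?_, fun R' hR' => ?_, ?_, ?_, ?_⟩⟩
  · rw [sphericalPoint, ← hΦ, AlgHom.comp_apply, hX]
    congr 1
    ext <;> simp [s, c, s', c'] <;> ring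
  · rw [sphericalFrame, (hasDerivAt_sphericalPoint_zero q hR').deriv, ← hΦ, AlgHom.comp_apply, hX]
    congr 1
    ext <;> simp [s, c, s', c'] <;> ring
  · rw [sphericalFrame_one, ← hΦ, AlgHom.comp_apply, hX]
    congr 1
    ext <;> simp [s, c, s', c'] <;> ring
  · rw [sphericalFrame_two, ← hΦ, AlgHom.comp_apply, hX]
    congr 1
    ext <;> simp [s, c, s', c'] <;> ring
  · rw [sphericalFrame_three, ← hΦ, AlgHom.comp_apply, hX]
    congr 1
    ext <;> simp [s, s', c']

theorem norm_sphericalPoint (hb : IsCanonicalBasis b) (R : ℝ → ℝ) (q : Fin 4 → ℝ) :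
    ‖sphericalPoint b R q‖ = |R (q 0)| := by
  obtain ⟨Ψ, hΨ⟩ := hb.exists_sphericalHom q
  rw [(hΨ R).1, Quaternion.norm_algHom, ← Real.sqrt_sq_eq_abs, norm_eq_sqrt_real_inner,
    Quaternion.inner_self, Quaternion.normSq_def']
  congr 1
  simp only [re_ofCoords, imI_ofCoords, imJ_ofCoords, imK_ofCoords]
  linear_combination R (q 0) ^ 2 * Real.sin_sq_add_cos_sq (q 1)

/-- After applying Ψ, the point and the η, χ vectors lie in the plane of 1 and i, while the θ, φ
vectors are multiples of j and k. The table lists the products x a⁻¹ y of these. -/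
theorem structureField_sphericalFrame (hb : IsCanonicalBasis b) (R : ℝ → ℝ) (R' : ℝ)
    (q : Fin 4 → ℝ) (hR : HasDerivAt R R' (q 0)) (hR0 : R (q 0) ≠ 0) (hR'0 : R' ≠ 0)
    (h1 : Real.sin (q 1) ≠ 0) (h2 : Real.sin (q 2) ≠ 0) :
    LinearIndependent ℝ (sphericalFrame b R q) ∧
      ∀ α β, structureField (sphericalPoint b R q) (sphericalFrame b R q α)
          (sphericalFrame b R q β) =
        ∑ γ, sphericalConstants (R' / R (q 0)) (q 1) (q 2) γ α β • sphericalFrame b R q γ := by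
  obtain ⟨Ψ, hΨ⟩ := hb.exists_sphericalHom q
  obtain ⟨hp, hf0, hf1, hf2, hf3⟩ := hΨ R
  replace hf0 := hf0 R' hR
  have hsc := Real.sin_sq_add_cos_sq (q 1)
  have hne : sphericalPoint b R q ≠ 0 := by
    rw [← norm_ne_zero_iff, norm_sphericalPoint hb]
    exact abs_ne_zero.2 hR0
  have hinj : Function.Injective Ψ := Ψ.toRingHom.injective
  have hinv : (ofCoords (R (q 0) * Real.cos (q 1)) (R (q 0) * Real.sin (q 1)) 0 0)⁻¹ =
      ofCoords (Real.cos (q 1) / R (q 0)) (-(Real.sin (q 1) / R (q 0))) 0 0 := by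
    refine inv_eq_of_mul_eq_one_right ?_
    ext
    · simp
      field_simp
      linear_combination hsc
    · simp
      field_simp
      ring
    · simp
    · simp
  constructor
  · rw [Fintype.linearIndependent_iff]
    intro g hg
    rw [Fin.sum_univ_four, hf0, hf1, hf2, hf3] at hg
    simp only [← map_smul, ← map_add] at hg
    have hg' := hinj (hg.trans (map_zero Ψ).symm)
    have e0 := congrArg QuaternionAlgebra.re hg'
    have e1 := congrArg QuaternionAlgebra.imI hg'
    have e2 := congrArg QuaternionAlgebra.imJ hg'
    have e3 := congrArg QuaternionAlgebra.imK hg'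
    simp [hR0, h1, h2] at e0 e1 e2 e3
    -- Rotating the first two equations by the angle χ separates the η and χ coefficients.
    have g0 : g 0 * R' = 0 := by
      linear_combination Real.cos (q 1) * e0 + Real.sin (q 1) * e1 - g 0 * R' * hsc
    have g1 : g 1 * R (q 0) = 0 := by
      linear_combination -Real.sin (q 1) * e0 + Real.cos (q 1) * e1 - g 1 * R (q 0) * hsc
    intro i
    fin_cases i
    exacts [(mul_eq_zero.1 g0).resolve_right hR'0, (mul_eq_zero.1 g1).resolve_right hR0, e2, e3]
  · intro α β
    rw [structureField_quaternion hne, Fin.sum_univ_four, hf0, hf1, hf2, hf3, hp]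
    have hC : Real.cos (q 1) ^ 2 = 1 - Real.sin (q 1) ^ 2 := by linear_combination hsc
    fin_cases α <;> fin_cases β <;>
      simp only [sphericalConstants, Fin.zero_eta, Fin.mk_one, Fin.reduceFinMk, hf0, hf1, hf2,
        hf3, ← map_inv₀, ← map_mul, hinv, ← map_smul, ← map_add] <;>
      congr 1 <;> ext <;> simp
    all_goals clear hf0 hf1 hf2 hf3 hp hinv hΨ hinj hne hb
    all_goals field_simp
    all_goals first | ring1 | (rw [hC]; ring1) | grind

end Spherical

/-! ### Topology of the group of nonzero quaternions. -/

section PerceptionDomain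

theorem perceptionDomain_quaternion_eq_range :
    perceptionDomain (Quaternion ℝ) = Set.range (Units.val : (Quaternion ℝ)ˣ → Quaternion ℝ) := by
  rw [perceptionDomain_quaternion]
  ext x
  exact ⟨fun h => ⟨Units.mk0 x h, rfl⟩, fun ⟨u, hu⟩ => hu ▸ u.ne_zero⟩

/-- The group of nonzero quaternions is homeomorphic to the product of the line and the
three-sphere. -/
theorem nonempty_units_quaternion_homeomorph :
    Nonempty ((Quaternion ℝ)ˣ ≃ₜ ℝ × Metric.sphere (0 : EuclideanSpace ℝ (Fin 4)) 1) := by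
  let e₁ : (Quaternion ℝ)ˣ ≃ₜ {x : Quaternion ℝ // x ≠ 0} := unitsHomeomorphNeZero
  let e₂ : {x : Quaternion ℝ // x ≠ 0} ≃ₜ ({0}ᶜ : Set (EuclideanSpace ℝ (Fin 4))) :=
    Quaternion.linearIsometryEquivTuple.toHomeomorph.subtype fun x =>
      (Quaternion.linearIsometryEquivTuple.map_eq_zero_iff (x := x)).not.symm
  let e₃ := homeomorphUnitSphereProd (EuclideanSpace ℝ (Fin 4))
  let e₄ : ℝ ≃ₜ Set.Ioi (0 : ℝ) := Real.expOrderIso.toHomeomorph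
  exact ⟨e₁.trans <| e₂.trans <| e₃.trans <|
    (Homeomorph.prodComm _ _).trans <| e₄.symm.prodCongr (Homeomorph.refl _)⟩

end PerceptionDomain

/-! ### Integral curves of left invariant fields. -/

section Vista

open Quaternion

theorem Quaternion.exp_smul_algHom (Ψ : Quaternion ℝ →ₐ[ℝ] Quaternion ℝ) (a b c d t : ℝ) :
    NormedSpace.exp (t • Ψ (ofCoords a b c d)) =
      Ψ (Real.exp (a * t) • ofCoords (Real.cos (√(b ^ 2 + c ^ 2 + d ^ 2) * t))
        (b / √(b ^ 2 + c ^ 2 + d ^ 2) * Real.sin (√(b ^ 2 + c ^ 2 + d ^ 2) * t))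
        (c / √(b ^ 2 + c ^ 2 + d ^ 2) * Real.sin (√(b ^ 2 + c ^ 2 + d ^ 2) * t))
        (d / √(b ^ 2 + c ^ 2 + d ^ 2) * Real.sin (√(b ^ 2 + c ^ 2 + d ^ 2) * t))) := by
  set ω := √(b ^ 2 + c ^ 2 + d ^ 2)
  have him : (t • Ψ (ofCoords a b c d)).im = t • Ψ (ofCoords 0 b c d) := by
    have h1 : (Ψ (ofCoords a b c d)) = Ψ (ofCoords 0 b c d) + (a : Quaternion ℝ) := by
      have : ofCoords a b c d = ofCoords 0 b c d + (a : Quaternion ℝ) := by ext <;> simp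
      rw [this, map_add]
      congr 1
      exact Ψ.commutes a
    have h2 : (Ψ (ofCoords 0 b c d)).re = 0 := re_algHom Ψ _
    rw [h1]
    ext <;> simp [h2]
  have hre : (t • Ψ (ofCoords a b c d)).re = a * t := by
    rw [re_smul, re_algHom, re_ofCoords, smul_eq_mul, mul_comm]
  have hnorm : ‖t • Ψ (ofCoords 0 b c d)‖ = |t| * ω := by
    rw [norm_smul, norm_algHom, Real.norm_eq_abs]
    congr 1
    rw [norm_eq_sqrt_real_inner, inner_self, normSq_def']
    simp [ω]
  have hcos : Real.cos (|t| * ω) = Real.cos (ω * t) := by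
    rw [← Real.cos_abs (ω * t), abs_mul, abs_of_nonneg (Real.sqrt_nonneg _), mul_comm]
  -- Evenness of sin(x)/x removes the absolute value. For ω = 0 both sides are 0 by the convention
  -- for division by zero.
  have hsin : Real.sin (|t| * ω) / (|t| * ω) * t = Real.sin (ω * t) / ω := by
    rcases lt_trichotomy t 0 with ht | rfl | ht
    · rw [abs_of_neg ht, neg_mul, Real.sin_neg, neg_div_neg_eq, mul_comm t ω]
      by_cases hω : ω = 0
      · simp [hω]
      · have := ht.ne
        field_simp
    · simp
    · rw [abs_of_pos ht, mul_comm t ω]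
      by_cases hω : ω = 0
      · simp [hω]
      · field_simp
  rw [Quaternion.exp_eq, him, hre, hnorm, hcos, ← Real.exp_eq_exp_ℝ, smul_smul, hsin, map_smul]
  congr 1
  have : ((Real.cos (ω * t) : ℝ) : Quaternion ℝ) = Ψ (Real.cos (ω * t) : ℝ) :=
    (Ψ.commutes _).symm
  rw [this, ← map_smul, ← map_add]
  congr 1
  ext <;> simp <;> ring

/-- The integral curves of the left invariant fields are given by the exponential. -/
theorem isVistaOn_iff_exp {u a : Quaternion ℝ} (ha : a ≠ 0) {J : Set ℝ} (hJ : IsOpen J)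
    (hJ' : J.OrdConnected) (h0 : 0 ∈ J) (γ : ℝ → Quaternion ℝ) :
    IsVistaOn J u a γ ↔ ∀ t ∈ J, γ t = a * NormedSpace.exp (t • u) := by
  let _ : NormedAlgebra ℚ (Quaternion ℝ) := NormedAlgebra.restrictScalars ℚ ℝ (Quaternion ℝ)
  have hexp : ∀ (u : Quaternion ℝ) (t : ℝ),
      NormedSpace.exp (t • u) * NormedSpace.exp (t • -u) = 1 := by
    intro u t
    rw [smul_neg, ← NormedSpace.exp_add_of_commute (Commute.refl _).neg_right, add_neg_cancel,
      NormedSpace.exp_zero]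
  constructor
  · rintro ⟨hγ0, -, hγ⟩ t ht
    -- Uniqueness: for an integral curve γ, the product γ(t) exp(-tu) has zero derivative and is
    -- constant on the interval J.
    have hderiv : ∀ t ∈ J, HasDerivAt (fun t => γ t * NormedSpace.exp (t • -u)) 0 t := by
      intro t ht
      have h1 := ((hγ t ht).hasDerivAt (hJ.mem_nhds ht)).mul
        (hasDerivAt_exp_smul_const' (𝕂 := ℝ) (-u) t)
      exact h1.congr_deriv (by noncomm_ring)
    have hconst := hJ.is_const_of_deriv_eq_zero hJ'.isPreconnected
      (fun t ht => (hderiv t ht).differentiableAt.differentiableWithinAt)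
      (fun t ht => (hderiv t ht).deriv) ht h0
    simp only [zero_smul, NormedSpace.exp_zero, mul_one, hγ0] at hconst
    have h2 := hexp (-u) t
    rw [neg_neg] at h2
    rw [← hconst, mul_assoc, h2, mul_one]
  · intro h
    refine ⟨by simp [h 0 h0], fun t ht => ?_, fun t ht => ?_⟩
    · rw [h t ht]
      exact mul_ne_zero ha (left_ne_zero_of_mul_eq_one (hexp u t))
    · have h1 := (hasDerivAt_exp_smul_const (𝕂 := ℝ) u t).const_mul a
      rw [← mul_assoc, ← h t ht] at h1
      exact (h1.congr_of_eventuallyEq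
        (Filter.eventually_of_mem (hJ.mem_nhds ht) h)).hasDerivWithinAt

theorem IsCanonicalBasis.isVistaOn_iff {b : Module.Basis (Fin 4) ℝ (Quaternion ℝ)}
    (hb : IsCanonicalBasis b) (u a : Fin 4 → ℝ) (ha : a ≠ 0) {J : Set ℝ} (hJ : IsOpen J)
    (hJ' : J.OrdConnected) (h0 : 0 ∈ J) (γ : ℝ → Quaternion ℝ) :
    IsVistaOn J (b.equivFun.symm u) (b.equivFun.symm a) γ ↔
      ∀ t ∈ J, γ t = b.equivFun.symm (vistaCoords u a t) := by
  obtain ⟨Ψ, hΨ⟩ := hb.exists_algHom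
  have hcoords : ∀ c : Fin 4 → ℝ,
      b.equivFun.symm c = Ψ (ofCoords (c 0) (c 1) (c 2) (c 3)) := by
    intro c
    rw [hΨ, Module.Basis.equivFun_symm_apply, Fin.sum_univ_four]
  have ha' : b.equivFun.symm a ≠ 0 := (map_ne_zero_iff _ b.equivFun.symm.injective).2 ha
  rw [isVistaOn_iff_exp ha' hJ hJ' h0]
  refine forall₂_congr fun t _ => ?_
  rw [hcoords u, hcoords a, Quaternion.exp_smul_algHom, ← map_mul, hcoords]
  congr! 2
  ext <;> simp [vistaCoords] <;> ring

end Vista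

/-! ### The time of a cosmology is a function of the norm. -/

section RadialProfile

open Quaternion

/-- The source of the Lorentzian signature: in x and y this form is positive on the line of a,
negative definite on its orthogonal complement, and has no mixed terms. -/
theorem Quaternion.inner_mul_inv_mul {a : Quaternion ℝ} (ha : a ≠ 0) (x y : Quaternion ℝ) :
    inner ℝ a (x * (a⁻¹ * y)) = 2 * inner ℝ a x * inner ℝ a y / ‖a‖ ^ 2 - inner ℝ x y := by
  have hn : ‖a‖ ^ 2 = normSq a := by rw [normSq_eq_norm_mul_self, sq]
  have hn0 : normSq a ≠ 0 := normSq_ne_zero.2 ha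
  rw [Quaternion.inv_def, hn, smul_mul_assoc, mul_smul_comm, inner_smul_right, eq_sub_iff_add_eq,
    eq_div_iff hn0, add_mul, mul_right_comm, inv_mul_cancel₀ hn0, one_mul]
  simp only [inner_def, normSq_def', re_mul, imI_mul, imJ_mul, imK_mul, re_star, imI_star,
    imJ_star, imK_star]
  ring

theorem GeneratesPrincipalMetric.contDiffOn {k : ℕ∞} {T : Quaternion ℝ → ℝ}
    (hT : GeneratesPrincipalMetric k (Quaternion ℝ) T) : ContDiffOn ℝ k T {0}ᶜ := by
  obtain ⟨⟨n, b, hb⟩, -⟩ := hT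
  have h := hb.comp (s := {0}ᶜ) (g := fun c : Fin n → ℝ => T (b.equivFun.symm c))
    (f := b.equivFun) b.equivFun.toContinuousLinearEquiv.contDiff.contDiffOn
    (fun x hx => by
      rw [Set.mem_ofPred_eq, b.equivFun.symm_apply_apply, perceptionDomain_quaternion]
      exact hx)
  refine h.congr fun x _ => ?_
  simp

variable {k : ℕ∞} {T : Quaternion ℝ → ℝ}

theorem principalMetric_eq_fderiv {a : Quaternion ℝ} (ha : a ≠ 0) (hT : DifferentiableAt ℝ T a)
    (x y : Quaternion ℝ) : principalMetric T a x y = fderiv ℝ T a (x * (a⁻¹ * y)) := by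
  rw [principalMetric, structureField_quaternion ha, hT.lineDeriv_eq_fderiv]

theorem ContDiffOn.differentiableAt_quaternion (hk : 1 ≤ k) (hT : ContDiffOn ℝ k T {0}ᶜ)
    {a : Quaternion ℝ} (ha : a ≠ 0) : DifferentiableAt ℝ T a :=
  (hT.contDiffAt (isOpen_compl_singleton.mem_nhds ha)).differentiableAt
    (by
      have : (1 : WithTop ℕ∞) ≤ k := by exact_mod_cast hk
      exact (zero_lt_one.trans_le this).ne')

/-- The derivative of the time vanishes along the left invariant fields generated by imaginary
quaternions. -/
theorem GeneratesPrincipalMetric.fderiv_mul_eq_zero (hk : 1 ≤ k)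
    (hT : GeneratesPrincipalMetric k (Quaternion ℝ) T) {a : Quaternion ℝ} (ha : a ≠ 0)
    {w : Quaternion ℝ} (hw : w.re = 0) : fderiv ℝ T a (a * w) = 0 := by
  have hd := hT.contDiffOn.differentiableAt_quaternion hk ha
  -- Symmetry of the metric on the vectors au and av, whose structure field values are auv and avu.
  have hcomm : ∀ u v : Quaternion ℝ, fderiv ℝ T a (a * (u * v - v * u)) = 0 := by
    intro u v
    have h := (hT.2 a (by rwa [perceptionDomain_quaternion])).1 (a * u) (a * v)
    rw [principalMetric_eq_fderiv ha hd, principalMetric_eq_fderiv ha hd,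
      inv_mul_cancel_left₀ ha, inv_mul_cancel_left₀ ha, mul_assoc, mul_assoc] at h
    rw [mul_sub, map_sub, h, sub_self]
  -- Since jk - kj = 2i and cyclically, commutators span the imaginary quaternions.
  have hw' : w = (w.imI / 2) • (ofCoords 0 0 1 0 * ofCoords 0 0 0 1 -
        ofCoords 0 0 0 1 * ofCoords 0 0 1 0) +
      (w.imJ / 2) • (ofCoords 0 0 0 1 * ofCoords 0 1 0 0 -
        ofCoords 0 1 0 0 * ofCoords 0 0 0 1) +
      (w.imK / 2) • (ofCoords 0 1 0 0 * ofCoords 0 0 1 0 -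
        ofCoords 0 0 1 0 * ofCoords 0 1 0 0) := by
    ext <;> simp [hw] <;> ring
  rw [hw', mul_add, mul_add, map_add, map_add, mul_smul_comm, mul_smul_comm, mul_smul_comm,
    map_smul, map_smul, map_smul, hcomm, hcomm, hcomm]
  simp

theorem Quaternion.exists_cos_add_sin_smul (p : Quaternion ℝ) (hp : ‖p‖ = 1) :
    ∃ (θ : ℝ) (n : Quaternion ℝ), n.re = 0 ∧ n * n = -1 ∧
      p = (Real.cos θ) • 1 + (Real.sin θ) • n := by
  have hsq : p.re ^ 2 + ‖p.im‖ ^ 2 = 1 := by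
    have h1 : ‖p‖ ^ 2 = 1 := by rw [hp, one_pow]
    rw [sq, ← normSq_eq_norm_mul_self, normSq_def'] at h1
    rw [sq ‖p.im‖, ← normSq_eq_norm_mul_self, normSq_def']
    simp only [re_im, imI_im, imJ_im, imK_im]
    linear_combination h1
  have hcos : Real.cos (Real.arccos p.re) = p.re :=
    Real.cos_arccos (by nlinarith [sq_nonneg ‖p.im‖]) (by nlinarith [sq_nonneg ‖p.im‖])
  have hsin : Real.sin (Real.arccos p.re) = ‖p.im‖ := by
    rw [Real.sin_arccos, ← Real.sqrt_sq (norm_nonneg p.im)]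
    congr 1
    linarith
  by_cases him : p.im = 0
  -- For real p the axis is undetermined and any imaginary unit serves.
  · refine ⟨Real.arccos p.re, ofCoords 0 1 0 0, rfl, by ext <;> simp, ?_⟩
    rw [hcos, hsin, him, norm_zero, zero_smul, add_zero]
    rw [← re_add_im p, him, add_zero]
    ext <;> simp
  · have hne : ‖p.im‖ ≠ 0 := norm_ne_zero_iff.2 him
    refine ⟨Real.arccos p.re, ‖p.im‖⁻¹ • p.im, by simp, ?_, ?_⟩
    · rw [smul_mul_smul_comm]
      have : p.im * p.im = -((‖p.im‖ * ‖p.im‖ : ℝ) : Quaternion ℝ) := by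
        have hN : ‖p.im‖ * ‖p.im‖ = p.imI ^ 2 + p.imJ ^ 2 + p.imK ^ 2 := by
          rw [← normSq_eq_norm_mul_self, normSq_def']
          simp
        generalize ‖p.im‖ * ‖p.im‖ = N at hN
        ext <;> simp
        · rw [hN]; ring
        all_goals ring
      rw [this]
      ext <;> simp
      field_simp
    · rw [hcos, hsin, smul_inv_smul₀ hne]
      ext <;> simp

/-- The circle |a|(cos t + n sin t), with n an imaginary unit, joins |a| to a and is an integral
curve of the field generated by n, along which dT vanishes. -/
theorem GeneratesPrincipalMetric.eq_apply_norm (hk : 1 ≤ k)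
    (hT : GeneratesPrincipalMetric k (Quaternion ℝ) T) (a : Quaternion ℝ) :
    T a = T (‖a‖ • 1) := by
  by_cases ha : a = 0
  · simp [ha]
  have hr : ‖a‖ ≠ 0 := norm_ne_zero_iff.2 ha
  obtain ⟨θ, n, hn, hnn, hp⟩ := exists_cos_add_sin_smul (‖a‖⁻¹ • a) (by
    rw [norm_smul, norm_inv, norm_norm, inv_mul_cancel₀ hr])
  set c : ℝ → Quaternion ℝ := fun t => ‖a‖ • ((Real.cos t) • 1 + (Real.sin t) • n)
  have hc : ∀ t, HasDerivAt c (c t * n) t := by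
    intro t
    have h1 := ((((Real.hasDerivAt_cos t).smul_const (1 : Quaternion ℝ)).add
      ((Real.hasDerivAt_sin t).smul_const n)).const_smul ‖a‖)
    refine h1.congr_deriv ?_
    simp only [c, smul_mul_assoc, add_mul, one_mul, hnn]
    module
  have hc0 : ∀ t, c t ≠ 0 := by
    intro t h
    have h1 : ((Real.cos t) • (1 : Quaternion ℝ) + (Real.sin t) • n) *
        ((Real.cos t) • (1 : Quaternion ℝ) - (Real.sin t) • n) = 1 := by
      simp only [add_mul, mul_sub, smul_mul_assoc, mul_smul_comm, one_mul, mul_one, hnn]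
      trans (Real.sin t ^ 2 + Real.cos t ^ 2) • (1 : Quaternion ℝ)
      · module
      · rw [Real.sin_sq_add_cos_sq, one_smul]
    rcases smul_eq_zero.1 h with h | h
    · exact hr h
    · rw [h, zero_mul] at h1
      exact zero_ne_one h1
  have hderiv : ∀ t, HasDerivAt (T ∘ c) 0 t := by
    intro t
    have h1 := (hT.contDiffOn.differentiableAt_quaternion hk (hc0 t)).hasFDerivAt.comp_hasDerivAt
      t (hc t)
    rwa [hT.fderiv_mul_eq_zero hk (hc0 t) hn] at h1
  have hconst := is_const_of_deriv_eq_zero (fun t => (hderiv t).differentiableAt)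
    (fun t => (hderiv t).deriv) θ 0
  simp only [c, Function.comp_apply] at hconst
  rw [← hp, smul_inv_smul₀ hr] at hconst
  simpa using hconst

/-- `T` is the function `f` of the norm, with `f` of class `C^k` without critical points. -/
structure HasRadialProfile (k : ℕ∞) (T : Quaternion ℝ → ℝ) (f : ℝ → ℝ) : Prop where
  contDiffOn : ContDiffOn ℝ k f (Set.Ioi 0)
  eq_norm : ∀ a, T a = f ‖a‖
  deriv_ne_zero : ∀ r, 0 < r → deriv f r ≠ 0

theorem hasFDerivAt_comp_norm {f : ℝ → ℝ} (hTf : ∀ a, T a = f ‖a‖) {a : Quaternion ℝ}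
    (ha : a ≠ 0) (hf : DifferentiableAt ℝ f ‖a‖) :
    HasFDerivAt T ((deriv f ‖a‖ / ‖a‖) • innerSL ℝ a) a := by
  have hr : ‖a‖ ≠ 0 := norm_ne_zero_iff.2 ha
  have h1 : HasFDerivAt (fun x : Quaternion ℝ => ‖x‖) (‖a‖⁻¹ • innerSL ℝ a) a := by
    have h2 := (hasStrictFDerivAt_norm_sq a).hasFDerivAt.sqrt (by positivity)
    simp only [Real.sqrt_sq (norm_nonneg _)] at h2
    refine h2.congr_fderiv ?_
    rw [two_smul, ← two_smul ℝ, smul_smul]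
    congr 1
    field_simp
  have h3 := hf.hasDerivAt.comp_hasFDerivAt a h1
  rw [smul_smul] at h3
  exact h3.congr_of_eventuallyEq (Filter.Eventually.of_forall hTf)

/-- The profile is f(r) = T(r·1). At a critical point of f the differential of T vanishes at r·1,
and the metric would be zero there. -/
theorem GeneratesPrincipalMetric.exists_hasRadialProfile (hk : 1 ≤ k)
    (hT : GeneratesPrincipalMetric k (Quaternion ℝ) T) : ∃ f, HasRadialProfile k T f := by
  have hf : ContDiffOn ℝ k (fun r : ℝ => T (r • 1)) (Set.Ioi 0) :=
    hT.contDiffOn.comp (t := {0}ᶜ) (f := fun r : ℝ => r • (1 : Quaternion ℝ))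
      (contDiff_id.smul contDiff_const).contDiffOn
      (fun r hr => smul_ne_zero (ne_of_gt hr) one_ne_zero)
  refine ⟨_, hf, hT.eq_apply_norm hk, fun r hr h0 => ?_⟩
  have hr0 : (r • 1 : Quaternion ℝ) ≠ 0 := smul_ne_zero hr.ne' one_ne_zero
  have hn : ‖(r • 1 : Quaternion ℝ)‖ = r := by
    rw [norm_smul, norm_one, mul_one, Real.norm_of_nonneg hr.le]
  have hk' : ((k : ℕ∞) : WithTop ℕ∞) ≠ 0 := by
    have : (1 : WithTop ℕ∞) ≤ k := by exact_mod_cast hk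
    exact (zero_lt_one.trans_le this).ne'
  have hd : DifferentiableAt ℝ (fun r : ℝ => T (r • 1)) ‖(r • 1 : Quaternion ℝ)‖ := by
    rw [hn]
    exact (hf.contDiffAt (Ioi_mem_nhds hr)).differentiableAt hk'
  have h1 := hasFDerivAt_comp_norm (hT.eq_apply_norm hk) hr0 hd
  rw [hn, h0, zero_div, zero_smul] at h1
  refine one_ne_zero ((hT.2 _ (by rwa [perceptionDomain_quaternion])).2 (1 : Quaternion ℝ)
    fun y => ?_)
  rw [principalMetric_eq_fderiv hr0 h1.differentiableAt, h1.fderiv]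
  rfl

namespace HasRadialProfile

variable {f : ℝ → ℝ}

theorem differentiableAt (hk : 1 ≤ k) (hf : HasRadialProfile k T f) {r : ℝ} (hr : 0 < r) :
    DifferentiableAt ℝ f r :=
  (hf.contDiffOn.contDiffAt (Ioi_mem_nhds hr)).differentiableAt
    (by
      have : (1 : WithTop ℕ∞) ≤ k := by exact_mod_cast hk
      exact (zero_lt_one.trans_le this).ne')

theorem hasFDerivAt (hk : 1 ≤ k) (hf : HasRadialProfile k T f) {a : Quaternion ℝ} (ha : a ≠ 0) :
    HasFDerivAt T ((deriv f ‖a‖ / ‖a‖) • innerSL ℝ a) a :=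
  hasFDerivAt_comp_norm hf.eq_norm ha (hf.differentiableAt hk (norm_pos_iff.2 ha))

theorem lineDeriv_eq (hk : 1 ≤ k) (hf : HasRadialProfile k T f) {a : Quaternion ℝ} (ha : a ≠ 0)
    (x : Quaternion ℝ) : lineDeriv ℝ T a x = deriv f ‖a‖ / ‖a‖ * inner ℝ a x := by
  have h := hf.hasFDerivAt hk ha
  rw [h.differentiableAt.lineDeriv_eq_fderiv, h.fderiv]
  rfl

theorem principalMetric_eq (hk : 1 ≤ k) (hf : HasRadialProfile k T f) {a : Quaternion ℝ}
    (ha : a ≠ 0) (x y : Quaternion ℝ) : principalMetric T a x y =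
      deriv f ‖a‖ / ‖a‖ * (2 * inner ℝ a x * inner ℝ a y / ‖a‖ ^ 2 - inner ℝ x y) := by
  rw [principalMetric, structureField_quaternion ha, hf.lineDeriv_eq hk ha,
    inner_mul_inv_mul ha]

/-- The derivative of the profile has constant sign. -/
theorem exists_sign (hk : 1 ≤ k) (hf : HasRadialProfile k T f) :
    ((∀ r, 0 < r → deriv f r = |deriv f r|) ∧ StrictMonoOn f (Set.Ioi 0)) ∨
      ((∀ r, 0 < r → deriv f r = -|deriv f r|) ∧ StrictAntiOn f (Set.Ioi 0)) := by
  -- Darboux: a derivative without zeros on an interval has constant sign.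
  rcases hasDerivWithinAt_forall_lt_or_forall_gt_of_forall_ne (convex_Ioi (0 : ℝ))
    (fun r hr => (hf.differentiableAt hk hr).hasDerivAt.hasDerivWithinAt) hf.deriv_ne_zero
    with h | h
  · right
    refine ⟨fun r hr => by rw [abs_of_neg (h r hr), neg_neg],
      strictAntiOn_of_deriv_neg (convex_Ioi 0) hf.contDiffOn.continuousOn fun r hr => ?_⟩
    rw [interior_Ioi] at hr
    exact h r hr
  · left
    refine ⟨fun r hr => by rw [abs_of_pos (h r hr)],
      strictMonoOn_of_deriv_pos (convex_Ioi 0) hf.contDiffOn.continuousOn fun r hr => ?_⟩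
    rw [interior_Ioi] at hr
    exact h r hr

/-- Functions with a radial profile generate principal metrics. -/
theorem generatesPrincipalMetric (hk : 1 ≤ k) (hf : HasRadialProfile k T f)
    (hT : ContDiffOn ℝ k T {0}ᶜ) : GeneratesPrincipalMetric k (Quaternion ℝ) T := by
  refine ⟨⟨4, (Module.finBasisOfFinrankEq ℝ (Quaternion ℝ) finrank_quaternion_real), ?_⟩,
    fun a ha => ?_⟩
  · rw [perceptionDomain_quaternion]
    exact hT.comp (LinearEquiv.toContinuousLinearEquiv _).contDiff.contDiffOn fun x hx => hx
  · rw [perceptionDomain_quaternion] at ha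
    have ha : a ≠ 0 := ha
    refine ⟨fun x y => ?_, fun x hx => ?_⟩
    · rw [hf.principalMetric_eq hk ha, hf.principalMetric_eq hk ha, real_inner_comm x y]
      ring
    · by_contra hx0
      -- For y = a x⁻¹ a the structure field takes the radial value a, on which dT is nonzero.
      have h := hx (a * (x⁻¹ * a))
      rw [principalMetric, structureField_quaternion ha, hf.lineDeriv_eq hk ha,
        inv_mul_cancel_left₀ ha, mul_inv_cancel_left₀ hx0] at h
      have hr : 0 < ‖a‖ := norm_pos_iff.2 ha
      exact mul_ne_zero (div_ne_zero (hf.deriv_ne_zero _ hr) hr.ne')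
        (inner_self_eq_zero.not.2 ha) h

end HasRadialProfile

/-- The squared norm is the time of a cosmology. -/
theorem exists_isCosmology_quaternion (hk : 1 ≤ k) :
    ∃ T : Quaternion ℝ → ℝ, IsCosmology k (Quaternion ℝ) (temporalOrder T) T := by
  refine ⟨fun x => ‖x‖ ^ 2, isCosmology_quaternion_iff.2 ?_⟩
  refine HasRadialProfile.generatesPrincipalMetric (f := fun r => r ^ 2) hk
    ⟨(contDiff_id.pow 2).contDiffOn, fun _ => rfl, fun r hr => ?_⟩ (contDiff_norm_sq ℝ).contDiffOn
  simp [hr.ne']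

end RadialProfile

/-! ### The radial coordinate with normalised time component. -/

section RadialFunction

open Quaternion

/-- A function of class `C^k` with positive derivative has an inverse of class `C^k`. -/
theorem exists_inverse_of_hasDerivAt {g g' : ℝ → ℝ} {n : WithTop ℕ∞} (hg : ContDiff ℝ n g)
    (hg' : ∀ x, HasStrictDerivAt g (g' x) x) (h0 : ∀ x, g' x ≠ 0) :
    ∃ (I : Set ℝ) (L : ℝ → ℝ), IsOpen I ∧ I.OrdConnected ∧ I.Nonempty ∧ ContDiffOn ℝ n L I ∧
      Set.BijOn L I Set.univ ∧ ∀ η ∈ I, HasDerivAt L (g' (L η))⁻¹ η := by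
  have hcont : Continuous g := hg.continuous
  have hinj : Function.Injective g := by
    rcases hasDerivWithinAt_forall_lt_or_forall_gt_of_forall_ne (convex_univ (𝕜 := ℝ))
      (fun x _ => (hg' x).hasDerivAt.hasDerivWithinAt) (fun x _ => h0 x) with h | h
    · exact (strictAnti_of_deriv_neg fun x => by
        rw [(hg' x).hasDerivAt.deriv]; exact h x trivial).injective
    · exact (strictMono_of_deriv_pos fun x => by
        rw [(hg' x).hasDerivAt.deriv]; exact h x trivial).injective
  have hemb := Topology.IsOpenEmbedding.of_continuous_injective_isOpenMap hcont hinj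
    (isOpenMap_of_hasStrictDerivAt hg' h0)
  let e := hemb.toOpenPartialHomeomorph g
  have he : ⇑e = g := rfl
  have htarget : e.target = Set.range g := hemb.toOpenPartialHomeomorph_target
  have hderiv : ∀ η ∈ Set.range g, HasDerivAt e.symm (g' (e.symm η))⁻¹ η := fun η hη =>
    e.hasDerivAt_symm (htarget ▸ hη) (h0 _) (hg' _).hasDerivAt
  refine ⟨Set.range g, e.symm, hemb.isOpen_range,
    (isPreconnected_range hcont).ordConnected, Set.range_nonempty g, fun η hη => ?_, ?_, hderiv⟩
  · exact (e.contDiffAt_symm_deriv (h0 _) (htarget ▸ hη) (hg' _).hasDerivAt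
      hg.contDiffAt).contDiffWithinAt
  · refine ⟨Set.mapsTo_univ _ _, ?_, ?_⟩
    · rw [← htarget]
      exact e.symm.injOn
    · intro x _
      exact ⟨g x, ⟨x, rfl⟩, e.left_inv (by simp [e])⟩

variable {k : ℕ∞} {T : Quaternion ℝ → ℝ} {f : ℝ → ℝ}

/-- The radial functions of a cosmology. -/
theorem HasRadialProfile.exists_radialFunction (hk : 1 ≤ k) (hf : HasRadialProfile k T f) (s : ℝ)
    (hs : s = 1 ∨ s = -1) : ∃ (I : Set ℝ) (R : ℝ → ℝ),
      IsOpen I ∧ I.OrdConnected ∧ I.Nonempty ∧ ContDiffOn ℝ k R I ∧ Set.BijOn R I (Set.Ioi 0) ∧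
      ∀ η ∈ I, HasDerivAt R (s * R η / √(|deriv f (R η)| * R η)) η := by
  -- The integrand below involves f' and is only of class C^m; integration restores the lost
  -- derivative.
  obtain ⟨m, rfl⟩ : ∃ m : ℕ∞, k = m + 1 := by
    obtain ⟨m, hm⟩ := exists_add_of_le hk
    exact ⟨m, by rw [hm, add_comm]⟩
  have hs0 : s ≠ 0 := by rcases hs with rfl | rfl <;> norm_num
  have hcast : ((m + 1 : ℕ∞) : WithTop ℕ∞) = (m : WithTop ℕ∞) + 1 := by push_cast; rfl
  have hp : ContDiff ℝ ((m + 1 : ℕ∞) : WithTop ℕ∞) (fun x => f (Real.exp x)) :=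
    contDiffOn_univ.1 (hf.contDiffOn.comp Real.contDiff_exp.contDiffOn fun x _ => Real.exp_pos x)
  have hp' : ∀ x, HasDerivAt (fun x => f (Real.exp x)) (deriv f (Real.exp x) * Real.exp x) x :=
    fun x => (hf.differentiableAt hk (Real.exp_pos x)).hasDerivAt.comp x (Real.hasDerivAt_exp x)
  have hderiv : deriv (fun x => f (Real.exp x)) =
      fun x => deriv f (Real.exp x) * Real.exp x := funext fun x => (hp' x).deriv
  have hne : ∀ x, deriv f (Real.exp x) * Real.exp x ≠ 0 := fun x =>
    mul_ne_zero (hf.deriv_ne_zero _ (Real.exp_pos x)) (Real.exp_pos x).ne'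
  -- In x = log r the equation for R reads dη/dx = s√|d f(eˣ)/dx|, because s⁻¹ = s. Its right side
  -- never vanishes, so absolute value and root stay smooth, and R is the exponential of the inverse
  -- of its primitive.
  have hψ : ContDiff ℝ m (fun x => s * √|deriv f (Real.exp x) * Real.exp x|) := by
    rw [hcast, contDiff_succ_iff_deriv, hderiv] at hp
    refine contDiff_const.mul (contDiff_iff_contDiffAt.2 fun x => ?_)
    exact (hp.2.2.contDiffAt.abs (hne x)).sqrt (abs_ne_zero.2 (hne x))
  have hψ0 : ∀ x, s * √|deriv f (Real.exp x) * Real.exp x| ≠ 0 := fun x =>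
    mul_ne_zero hs0 (Real.sqrt_ne_zero'.2 (abs_pos.2 (hne x)))
  have hg := fun x => hψ.continuous.integral_hasStrictDerivAt 0 x
  have hgC : ContDiff ℝ ((m + 1 : ℕ∞) : WithTop ℕ∞)
      (fun x => ∫ t in (0 : ℝ)..x, s * √|deriv f (Real.exp t) * Real.exp t|) := by
    rw [hcast, contDiff_succ_iff_deriv]
    refine ⟨fun x => (hg x).hasDerivAt.differentiableAt,
      fun h => absurd h (WithTop.coe_ne_top), ?_⟩
    rwa [show deriv _ = _ from funext fun x => (hg x).hasDerivAt.deriv]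
  obtain ⟨I, L, hI, hI', hI0, hL, hbij, hL'⟩ := exists_inverse_of_hasDerivAt hgC hg hψ0
  refine ⟨I, fun η => Real.exp (L η), hI, hI', hI0, Real.contDiff_exp.comp_contDiffOn hL, ?_,
    fun η hη => ?_⟩
  · refine Set.BijOn.comp (g := Real.exp) (t := Set.univ) ⟨fun x _ => Real.exp_pos x,
      Real.exp_injective.injOn, fun y hy => ?_⟩ hbij
    exact ⟨Real.log y, trivial, Real.exp_log hy⟩
  · refine (hL' η hη).exp.congr_deriv ?_
    rw [abs_mul, abs_of_pos (Real.exp_pos _)]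
    have : s⁻¹ = s := by rcases hs with rfl | rfl <;> norm_num
    rw [mul_inv, this]
    ring

/-- Here |f'(R) R'| = |f'|R/√(|f'|R) = √(|f'|R). The equation for R stated through f is thus the
intended R'/R = s/|dT/dη|. -/
theorem HasRadialProfile.abs_deriv_ray (hk : 1 ≤ k) (hf : HasRadialProfile k T f) {s : ℝ}
    (hs : s = 1 ∨ s = -1) {R : ℝ → ℝ} {η : ℝ} (hR : 0 < R η)
    (hR' : HasDerivAt R (s * R η / √(|deriv f (R η)| * R η)) η) {p : Quaternion ℝ}
    (hp : ‖p‖ = 1) : |deriv (fun τ => T (R τ • p)) η| = √(|deriv f (R η)| * R η) := by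
  have habs : (fun τ => T (R τ • p)) =ᶠ[nhds η] fun τ => f (R τ) := by
    filter_upwards [hR'.continuousAt.eventually (lt_mem_nhds hR)] with τ hτ
    rw [hf.eq_norm, norm_smul, hp, mul_one, Real.norm_of_nonneg hτ.le]
  have hpos : 0 < |deriv f (R η)| * R η := mul_pos (abs_pos.2 (hf.deriv_ne_zero _ hR)) hR
  have h := (hf.differentiableAt hk hR).hasDerivAt.comp η hR'
  rw [habs.deriv_eq, show deriv (fun τ => f (R τ)) η = _ from h.deriv, abs_mul, abs_div, abs_mul,
    abs_of_pos hR, abs_of_pos (Real.sqrt_pos.2 hpos),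
    show |s| = 1 by rcases hs with rfl | rfl <;> simp, one_mul, mul_div_assoc', Real.div_sqrt]

/-- The radial functions are exponentials of primitives. -/
theorem HasRadialProfile.exists_radialFunction_eq_exp (hk : 1 ≤ k) (hf : HasRadialProfile k T f)
    (s : ℝ) (hs : s = 1 ∨ s = -1) : ∃ (I : Set ℝ) (R : ℝ → ℝ),
      IsOpen I ∧ I.OrdConnected ∧ I.Nonempty ∧ ContDiffOn ℝ k R I ∧
      Set.BijOn R I (Set.Ioi 0) ∧
      ∀ η ∈ I, deriv R η ≠ 0 ∧ ∀ p : Quaternion ℝ, ‖p‖ = 1 →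
        deriv R η = s * R η / |deriv (fun τ => T (R τ • p)) η| ∧
        ∀ η₀ ∈ I, R η =
          R η₀ * Real.exp (∫ t in η₀..η, s / |deriv (fun τ => T (R τ • p)) t|) := by
  obtain ⟨I, R, hI, hI', hI0, hR, hbij, hR'⟩ := hf.exists_radialFunction hk s hs
  have hs0 : s ≠ 0 := by rcases hs with rfl | rfl <;> norm_num
  have hpos : ∀ η ∈ I, 0 < R η := fun η hη => hbij.mapsTo hη
  have hpos' : ∀ η ∈ I, 0 < √(|deriv f (R η)| * R η) := fun η hη =>
    Real.sqrt_pos.2 (mul_pos (abs_pos.2 (hf.deriv_ne_zero _ (hpos η hη))) (hpos η hη))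
  refine ⟨I, R, hI, hI', hI0, hR, hbij, fun η hη => ⟨?_, fun p hp => ⟨?_, fun η₀ hη₀ => ?_⟩⟩⟩
  · rw [(hR' η hη).deriv]
    exact div_ne_zero (mul_ne_zero hs0 (hpos η hη).ne') (hpos' η hη).ne'
  · rw [(hR' η hη).deriv, hf.abs_deriv_ray hk hs (hpos η hη) (hR' η hη) hp]
  · have hsub : Set.uIcc η₀ η ⊆ I := hI'.uIcc_subset hη₀ hη
    -- log R is a primitive of the integrand, so the exponential formula is the fundamental theorem
    -- of calculus.
    have hlog : ∀ t ∈ Set.uIcc η₀ η, HasDerivAt (fun t => Real.log (R t))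
        (s / |deriv (fun τ => T (R τ • p)) t|) t := by
      intro t ht
      have hRt := hpos t (hsub ht)
      refine ((hR' t (hsub ht)).log hRt.ne').congr_deriv ?_
      rw [hf.abs_deriv_ray hk hs hRt (hR' t (hsub ht)) hp]
      field_simp
    have hcont : ContinuousOn (fun t => s / |deriv (fun τ => T (R τ • p)) t|)
        (Set.uIcc η₀ η) := by
      have h1 : ContinuousOn (deriv f) (Set.Ioi 0) :=
        hf.contDiffOn.continuousOn_deriv_of_isOpen isOpen_Ioi (by exact_mod_cast hk)
      have h2 : ContinuousOn R (Set.uIcc η₀ η) := hR.continuousOn.mono hsub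
      have h3 : ContinuousOn (fun t => s / √(|deriv f (R t)| * R t)) (Set.uIcc η₀ η) :=
        continuousOn_const.div (((h1.comp h2 fun t ht => hpos t (hsub ht)).abs.mul h2).sqrt)
          fun t ht => (hpos' t (hsub ht)).ne'
      refine h3.congr fun t ht => ?_
      simp only
      rw [hf.abs_deriv_ray hk hs (hpos t (hsub ht)) (hR' t (hsub ht)) hp]
    rw [intervalIntegral.integral_eq_sub_of_hasDerivAt hlog hcont.intervalIntegrable, Real.exp_sub,
      Real.exp_log (hpos η hη), Real.exp_log (hpos η₀ hη₀), mul_div_cancel₀ _ (hpos η₀ hη₀).ne']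

/-- The metric of a cosmology is closed FLRW. -/
theorem HasRadialProfile.isClosedFLRW (hk : 1 ≤ k) (hf : HasRadialProfile k T f) :
    IsClosedFLRW k ({0}ᶜ : Set (Quaternion ℝ)) (principalMetric T) := by
  obtain ⟨I, R, hI, hI', hI0, hR, hbij, hR'⟩ := hf.exists_radialFunction hk 1 (Or.inl rfl)
  have hpos : ∀ η ∈ I, 0 < R η := fun η hη => hbij.mapsTo hη
  obtain ⟨ε, hε, hεf⟩ : ∃ ε : ℝ, (ε = 1 ∨ ε = -1) ∧ ∀ r, 0 < r → deriv f r = ε * |deriv f r| := by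
    rcases hf.exists_sign hk with ⟨h, -⟩ | ⟨h, -⟩
    · exact ⟨1, Or.inl rfl, by simpa using h⟩
    · exact ⟨-1, Or.inr rfl, by simpa using h⟩
  let ι := linearIsometryEquivTuple.symm
  have hι : ∀ x, ‖ι x‖ = ‖x‖ := ι.norm_map
  refine ⟨I, fun η => √(|deriv f (R η)| * R η), ε, fun q => R q.1 • ι q.2, hI, hI', hI0,
    fun η hη => Real.sqrt_pos.2 (mul_pos (abs_pos.2 (hf.deriv_ne_zero _ (hpos η hη))) (hpos η hη)),
    hε, ?_, ⟨?_, ?_, ?_⟩, ?_⟩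
  · exact (hR.comp contDiff_fst.contDiffOn fun q hq => hq.1).smul
      (ι.contDiff.comp contDiff_snd).contDiffOn
  · rintro ⟨η, p⟩ ⟨hη, hp⟩
    refine smul_ne_zero (hpos η hη).ne' (norm_ne_zero_iff.1 ?_)
    rw [hι, mem_sphere_zero_iff_norm.1 hp]
    exact one_ne_zero
  · rintro ⟨η, p⟩ ⟨hη, hp⟩ ⟨η', p'⟩ ⟨hη', hp'⟩ h
    have hη : η ∈ I := hη
    have hη' : η' ∈ I := hη'
    have hp : ‖p‖ = 1 := mem_sphere_zero_iff_norm.1 hp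
    have hp' : ‖p'‖ = 1 := mem_sphere_zero_iff_norm.1 hp'
    have h : R η • ι p = R η' • ι p' := h
    have hn := congrArg norm h
    rw [norm_smul, norm_smul, hι, hι, hp, hp', mul_one, mul_one,
      Real.norm_of_nonneg (hpos η hη).le, Real.norm_of_nonneg (hpos η' hη').le] at hn
    obtain rfl := hbij.injOn hη hη' hn
    rw [ι.injective (smul_right_injective _ (hpos η hη).ne' h)]
  · intro a ha
    have hr : 0 < ‖a‖ := norm_pos_iff.2 ha
    obtain ⟨η, hη, hRη⟩ := hbij.surjOn hr
    refine ⟨(η, ι.symm (‖a‖⁻¹ • a)), ⟨hη, mem_sphere_zero_iff_norm.2 ?_⟩, ?_⟩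
    · rw [ι.symm.norm_map, norm_smul, norm_inv, norm_norm, inv_mul_cancel₀ hr.ne']
    · simp [hRη, smul_inv_smul₀ hr.ne']
  · intro η hη p hp x y v w hv hw
    have hp : ‖p‖ = 1 := mem_sphere_zero_iff_norm.1 hp
    have hRη := hpos η hη
    have hf0 := abs_pos.2 (hf.deriv_ne_zero _ hRη)
    -- The differential of R(η)p splits into a tangential part R·v and a radial part x·R', with R' =
    -- R/√(|f'|R).
    have hd : ∀ (x : ℝ) (v : EuclideanSpace ℝ (Fin 4)),
        fderiv ℝ (fun q : ℝ × EuclideanSpace ℝ (Fin 4) => R q.1 • ι q.2) (η, p) (x, v) =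
          R η • ι v + (x * (R η / √(|deriv f (R η)| * R η))) • ι p := by
      intro x v
      have h1 : HasFDerivAt (fun q : ℝ × EuclideanSpace ℝ (Fin 4) => R q.1) _ (η, p) :=
        (hR' η hη).hasFDerivAt.comp (η, p) hasFDerivAt_fst
      have h2 : HasFDerivAt (fun q : ℝ × EuclideanSpace ℝ (Fin 4) => ι q.2) _ (η, p) :=
        ι.toContinuousLinearEquiv.toContinuousLinearMap.hasFDerivAt.comp (η, p) hasFDerivAt_snd
      have h3 : HasFDerivAt (fun q : ℝ × EuclideanSpace ℝ (Fin 4) => R q.1 • ι q.2) _ (η, p) :=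
        h1.smul h2
      rw [h3.fderiv]
      simp
    have hne : R η • ι p ≠ 0 := smul_ne_zero hRη.ne' (norm_ne_zero_iff.1 (by rw [hι, hp]; simp))
    have hnorm : ‖R η • ι p‖ = R η := by
      rw [norm_smul, hι, hp, mul_one, Real.norm_of_nonneg hRη.le]
    have hpp : inner ℝ p p = (1 : ℝ) := by rw [real_inner_self_eq_norm_sq, hp, one_pow]
    have hvp : inner ℝ v p = (0 : ℝ) := by rw [real_inner_comm, hv]
    rw [hf.principalMetric_eq hk hne, hd, hd, hnorm]
    simp only [inner_add_right, inner_add_left, inner_smul_right, inner_smul_left,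
      LinearIsometryEquiv.inner_map_map, hv, hw, hpp, hvp, RCLike.conj_to_real]
    have hsq : √(|deriv f (R η)| * R η) ^ 2 = |deriv f (R η)| * R η := Real.sq_sqrt (by positivity)
    have hsq0 : √(|deriv f (R η)| * R η) ≠ 0 := Real.sqrt_ne_zero'.2 (by positivity)
    generalize √(|deriv f (R η)| * R η) = S at *
    rw [hεf _ hRη]
    have hF : |deriv f (R η)| = S ^ 2 / R η := by rw [hsq]; field_simp
    rw [hF]
    field_simp
    ring

end RadialFunction

/-! ### Metric and differential of the time in the spherical frame. -/

section SphericalComponents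

open Quaternion

theorem Quaternion.inner_ofCoords (a b c d a' b' c' d' : ℝ) :
    inner ℝ (ofCoords a b c d) (ofCoords a' b' c' d') = a * a' + b * b' + c * c' + d * d' := by
  rw [inner_def]
  simp

/-- Inner products of the spherical frame with the point and with itself. -/
theorem IsCanonicalBasis.inner_sphericalFrame {b : Module.Basis (Fin 4) ℝ (Quaternion ℝ)}
    (hb : IsCanonicalBasis b) {R : ℝ → ℝ} {R' : ℝ} {q : Fin 4 → ℝ} (hR : HasDerivAt R R' (q 0)) :
    (∀ α, inner ℝ (sphericalPoint b R q) (sphericalFrame b R q α) = ![R (q 0) * R', 0, 0, 0] α) ∧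
      ∀ α β, inner ℝ (sphericalFrame b R q α) (sphericalFrame b R q β) =
        Matrix.diagonal ![R' ^ 2, R (q 0) ^ 2, R (q 0) ^ 2 * Real.sin (q 1) ^ 2,
          R (q 0) ^ 2 * Real.sin (q 1) ^ 2 * Real.sin (q 2) ^ 2] α β := by
  obtain ⟨Ψ, hΨ⟩ := hb.exists_sphericalHom q
  obtain ⟨hp, hf0, hf1, hf2, hf3⟩ := hΨ R
  replace hf0 := hf0 R' hR
  have hsc := Real.sin_sq_add_cos_sq (q 1)
  constructor
  · intro α
    fin_cases α <;> simp only [Fin.zero_eta, Fin.mk_one, Fin.reduceFinMk, hp, hf0, hf1, hf2, hf3,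
      inner_algHom, inner_ofCoords] <;> simp
    · linear_combination R (q 0) * R' * hsc
    · ring
  · intro α β
    fin_cases α <;> fin_cases β <;>
      simp only [Fin.zero_eta, Fin.mk_one, Fin.reduceFinMk, hf0, hf1, hf2, hf3, inner_algHom,
        inner_ofCoords] <;> simp
    · linear_combination R' ^ 2 * hsc
    · ring
    · ring
    · linear_combination R (q 0) ^ 2 * hsc
    · ring
    · ring

variable {k : ℕ∞} {T : Quaternion ℝ → ℝ} {f : ℝ → ℝ} {b : Module.Basis (Fin 4) ℝ (Quaternion ℝ)}

namespace HasRadialProfile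

/-- The differential of the time in spherical coordinates. -/
theorem lineDeriv_sphericalFrame (hk : 1 ≤ k) (hf : HasRadialProfile k T f)
    (hb : IsCanonicalBasis b) (R : ℝ → ℝ) (q : Fin 4 → ℝ) (hR : DifferentiableAt ℝ R (q 0))
    (hR0 : R (q 0) ≠ 0) :
    DifferentiableAt ℝ (fun s => T (sphericalPoint b R (Function.update q 0 s))) (q 0) ∧
      ∀ α, lineDeriv ℝ T (sphericalPoint b R q) (sphericalFrame b R q α) =
        ![etaDeriv b R T q, 0, 0, 0] α := by
  have hne : sphericalPoint b R q ≠ 0 := by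
    rw [← norm_ne_zero_iff, norm_sphericalPoint hb]
    exact abs_ne_zero.2 hR0
  have hpt := hasDerivAt_sphericalPoint_zero (b := b) q hR.hasDerivAt
  have hfd := hf.hasFDerivAt hk hne
  have hfd' : HasFDerivAt T (fderiv ℝ T (sphericalPoint b R q))
      (sphericalPoint b R (Function.update q 0 (q 0))) := by
    rw [Function.update_eq_self]
    exact hfd.differentiableAt.hasFDerivAt
  have hcomp := hfd'.comp_hasDerivAt (q 0) hpt
  refine ⟨hcomp.differentiableAt, fun α => ?_⟩
  by_cases hα : α = 0
  · subst hα
    rw [hfd.differentiableAt.lineDeriv_eq_fderiv]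
    exact ((hcomp.deriv).trans (by rw [sphericalFrame, hpt.deriv])).symm
  -- The angular frame vectors are orthogonal to the point, hence to the gradient of T.
  · rw [hf.lineDeriv_eq hk hne, (hb.inner_sphericalFrame hR.hasDerivAt).1]
    fin_cases α <;> simp at hα ⊢

/-- The metric of a cosmology in spherical coordinates. -/
theorem principalMetric_sphericalFrame (hk : 1 ≤ k) (hf : HasRadialProfile k T f)
    (hb : IsCanonicalBasis b) {ε : ℝ} (hε : ∀ r, 0 < r → deriv f r = ε * |deriv f r|) (R : ℝ → ℝ)
    (R' s : ℝ) (q : Fin 4 → ℝ) (hR : HasDerivAt R R' (q 0)) (hR0 : R (q 0) ≠ 0) (hR'0 : R' ≠ 0)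
    (hs : s = 1 ∨ s = -1) (hRs : R' = s * R (q 0) / |etaDeriv b R T q|) :
    |etaDeriv b R T q| = √|lineDeriv ℝ T (sphericalPoint b R q) (sphericalPoint b R q)| ∧
      ∀ α β, principalMetric T (sphericalPoint b R q) (sphericalFrame b R q α)
          (sphericalFrame b R q β) =
        ε * Matrix.diagonal ![1, -|etaDeriv b R T q| ^ 2,
          -|etaDeriv b R T q| ^ 2 * Real.sin (q 1) ^ 2,
          -|etaDeriv b R T q| ^ 2 * Real.sin (q 1) ^ 2 * Real.sin (q 2) ^ 2] α β := by
  have hnorm := norm_sphericalPoint hb R q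
  have hne : sphericalPoint b R q ≠ 0 := by
    rw [← norm_ne_zero_iff, hnorm]
    exact abs_ne_zero.2 hR0
  have hr : 0 < abs (R (q 0)) := abs_pos.2 hR0
  have hpos : 0 < |deriv f (abs (R (q 0)))| := abs_pos.2 (hf.deriv_ne_zero _ hr)
  obtain ⟨hin1, hin2⟩ := hb.inner_sphericalFrame hR
  have heta : |etaDeriv b R T q| = |deriv f (abs (R (q 0)))| * |R'| := by
    have h := (hf.lineDeriv_sphericalFrame hk hb R q hR.differentiableAt hR0).2 0
    rw [hf.lineDeriv_eq hk hne, hin1, hnorm] at h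
    rw [show etaDeriv b R T q = _ from h.symm]
    simp only [Matrix.cons_val_zero, abs_mul, abs_div, abs_abs]
    field_simp
  have hs1 : |s| = 1 := by rcases hs with rfl | rfl <;> simp
  -- Taking absolute values in the condition on R', which allows negative R, gives |f'|R'² = |R|.
  -- This normalises the η component and yields 𝔞² = |f'||R|.
  have hsq : |deriv f (abs (R (q 0)))| * R' ^ 2 = abs (R (q 0)) := by
    have h := congrArg abs hRs
    rw [abs_div, abs_mul, hs1, one_mul, abs_abs, heta,
      eq_div_iff (mul_pos hpos (abs_pos.2 hR'0)).ne'] at h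
    rw [← sq_abs R']
    linear_combination h
  have hsq' : |etaDeriv b R T q| ^ 2 = |deriv f (abs (R (q 0)))| * abs (R (q 0)) := by
    rw [heta, mul_pow, sq_abs R']
    linear_combination |deriv f (abs (R (q 0)))| * hsq
  constructor
  · rw [hf.lineDeriv_eq hk hne, hnorm, real_inner_self_eq_norm_sq, hnorm]
    rw [show deriv f (abs (R (q 0))) / abs (R (q 0)) * abs (R (q 0)) ^ 2 =
      deriv f (abs (R (q 0))) * abs (R (q 0)) by field_simp, abs_mul, abs_abs, ← hsq',
      Real.sqrt_sq (abs_nonneg _)]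
  · intro α β
    rw [hf.principalMetric_eq hk hne, hin1, hin1, hin2, hnorm, hsq']
    have hd := hε _ hr
    generalize hrR : abs (R (q 0)) = r at *
    generalize |deriv f r| = F at *
    rw [hd]
    have hR2 : R (q 0) ^ 2 = r ^ 2 := by rw [← hrR, sq_abs]
    have hF : F = r / R' ^ 2 := by rw [← hsq]; field_simp
    have hr0 := hr.ne'
    have hRR : 2 * (R (q 0) * R') * (R (q 0) * R') = 2 * r ^ 2 * R' ^ 2 := by
      linear_combination 2 * R' ^ 2 * hR2
    fin_cases α <;> fin_cases β <;> simp [hR2, hF, hRR]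
    · field_simp
      ring
    all_goals field_simp

/-- The time is a strictly monotone function of the radial coordinate. -/
theorem exists_strictMonoOn_or_strictAntiOn (hk : 1 ≤ k) (hf : HasRadialProfile k T f)
    (hb : IsCanonicalBasis b) {J : Set ℝ} {R : ℝ → ℝ} (hJ : J.OrdConnected)
    (hR : ∀ η ∈ J, R η ≠ 0 ∧ DifferentiableAt ℝ R η ∧ deriv R η ≠ 0) :
    ∃ F : ℝ → ℝ, (∀ q : Fin 4 → ℝ, q 0 ∈ J → T (sphericalPoint b R q) = F (q 0)) ∧
      (StrictMonoOn F J ∨ StrictAntiOn F J) := by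
  refine ⟨fun η => f |R η|, fun q _ => by rw [hf.eq_norm, norm_sphericalPoint hb], ?_⟩
  have hd : ∀ η ∈ J, HasDerivAt (fun η => f |R η|)
      (deriv f |R η| * (SignType.sign (R η) * deriv R η)) η := by
    intro η hη
    obtain ⟨h0, h1, -⟩ := hR η hη
    exact (hf.differentiableAt hk (abs_pos.2 h0)).hasDerivAt.comp η
      ((hasDerivAt_abs h0).comp η h1.hasDerivAt)
  have hne : ∀ η ∈ J, deriv f |R η| * (SignType.sign (R η) * deriv R η) ≠ 0 := by
    intro η hη
    obtain ⟨h0, -, h2⟩ := hR η hη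
    refine mul_ne_zero (hf.deriv_ne_zero _ (abs_pos.2 h0)) (mul_ne_zero ?_ h2)
    rcases lt_or_gt_of_ne h0 with h | h <;> simp [h]
  have hcont : ContinuousOn (fun η => f |R η|) J := fun η hη =>
    (hd η hη).continuousAt.continuousWithinAt
  -- R' is not assumed continuous, so constancy of sign again rests on the Darboux property.
  rcases hasDerivWithinAt_forall_lt_or_forall_gt_of_forall_ne hJ.convex
    (fun η hη => (hd η hη).hasDerivWithinAt) hne with h | h
  · exact Or.inr (strictAntiOn_of_deriv_neg hJ.convex hcont fun η hη => by
      rw [(hd η (interior_subset hη)).deriv]; exact h η (interior_subset hη))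
  · exact Or.inl (strictMonoOn_of_deriv_pos hJ.convex hcont fun η hη => by
      rw [(hd η (interior_subset hη)).deriv]; exact h η (interior_subset hη))

end HasRadialProfile

end SphericalComponents

/-! ### The main theorem. -/

open scoped Manifold ContDiff in
theorem mainTheorem1 (k : ℕ∞) (hk : 1 ≤ k) :
    -- existence and essential uniqueness of the cosmology
    (∃ T : Quaternion ℝ → ℝ, IsCosmology k (Quaternion ℝ) (temporalOrder T) T) ∧
    (∀ (A : Type) [NonUnitalNonAssocRing A] [Module ℝ A] [IsScalarTower ℝ A A]
      [SMulCommClass ℝ A A] (R : A → A → Prop) (T : A → ℝ), IsCosmology k A R T →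
        R = temporalOrder T ∧
        ∃ φ : A ≃ₗ[ℝ] Quaternion ℝ, (∀ x y, φ (x * y) = φ x * φ y) ∧
          IsCosmology k (Quaternion ℝ) (fun x y => R (φ.symm x) (φ.symm y)) (T ∘ φ.symm)) ∧
    -- the perception domain is the Lie group of nonzero quaternions, of dimension four,
    -- homeomorphic to the product of the line and the three-sphere
    (perceptionDomain (Quaternion ℝ) = {0}ᶜ ∧
      perceptionDomain (Quaternion ℝ) = Set.range (Units.val : (Quaternion ℝ)ˣ → Quaternion ℝ) ∧
      Topology.IsOpenEmbedding (Units.val : (Quaternion ℝ)ˣ → Quaternion ℝ) ∧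
      LieGroup 𝓘(ℝ, Quaternion ℝ) ∞ (Quaternion ℝ)ˣ ∧
      Module.finrank ℝ (Quaternion ℝ) = 4 ∧
      Nonempty ((Quaternion ℝ)ˣ ≃ₜ ℝ × Metric.sphere (0 : EuclideanSpace ℝ (Fin 4)) 1)) ∧
    -- the structure field in spherical coordinates
    (∀ b, IsCanonicalBasis b → ∀ (R : ℝ → ℝ) (R' : ℝ) (q : Fin 4 → ℝ),
      HasDerivAt R R' (q 0) → R (q 0) ≠ 0 → R' ≠ 0 → Real.sin (q 1) ≠ 0 → Real.sin (q 2) ≠ 0 →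
        LinearIndependent ℝ (sphericalFrame b R q) ∧
        ∀ α β, structureField (sphericalPoint b R q) (sphericalFrame b R q α)
            (sphericalFrame b R q β) =
          ∑ γ, sphericalConstants (R' / R (q 0)) (q 1) (q 2) γ α β • sphericalFrame b R q γ) ∧
    -- the vistas
    (∀ b, IsCanonicalBasis b → ∀ u a : Fin 4 → ℝ, a ≠ 0 → ∀ J : Set ℝ, IsOpen J →
      J.OrdConnected → 0 ∈ J → ∀ γ : ℝ → Quaternion ℝ,
        IsVistaOn J (b.equivFun.symm u) (b.equivFun.symm a) γ ↔
          ∀ t ∈ J, γ t = b.equivFun.symm (vistaCoords u a t)) ∧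
    -- the time and the metric of a cosmology
    ∀ T : Quaternion ℝ → ℝ, IsCosmology k (Quaternion ℝ) (temporalOrder T) T →
      -- the metric is closed FLRW
      IsClosedFLRW k ({0}ᶜ : Set (Quaternion ℝ)) (principalMetric T) ∧
      -- its components in spherical coordinates
      (∃ ε : ℝ,
        ((ε = 1 ∧ ∀ x y : Quaternion ℝ, x ≠ 0 → ‖x‖ < ‖y‖ → T x < T y) ∨
          (ε = -1 ∧ ∀ x y : Quaternion ℝ, x ≠ 0 → ‖x‖ < ‖y‖ → T y < T x)) ∧
        ∀ b, IsCanonicalBasis b → ∀ (R : ℝ → ℝ) (R' s : ℝ) (q : Fin 4 → ℝ),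
          HasDerivAt R R' (q 0) → R (q 0) ≠ 0 → R' ≠ 0 → (s = 1 ∨ s = -1) →
          R' = s * R (q 0) / |etaDeriv b R T q| →
            |etaDeriv b R T q| =
              √|lineDeriv ℝ T (sphericalPoint b R q) (sphericalPoint b R q)| ∧
            ∀ α β, principalMetric T (sphericalPoint b R q) (sphericalFrame b R q α)
                (sphericalFrame b R q β) =
              ε * Matrix.diagonal ![1, -|etaDeriv b R T q| ^ 2,
                -|etaDeriv b R T q| ^ 2 * Real.sin (q 1) ^ 2,
                -|etaDeriv b R T q| ^ 2 * Real.sin (q 1) ^ 2 * Real.sin (q 2) ^ 2] α β) ∧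
      -- existence of the radial functions, `R = exp ∫ ± dη / |dT/dη|`
      (∀ s : ℝ, (s = 1 ∨ s = -1) → ∃ (I : Set ℝ) (R : ℝ → ℝ),
        IsOpen I ∧ I.OrdConnected ∧ I.Nonempty ∧ ContDiffOn ℝ k R I ∧
        Set.BijOn R I (Set.Ioi 0) ∧
        ∀ η ∈ I, deriv R η ≠ 0 ∧ ∀ p : Quaternion ℝ, ‖p‖ = 1 →
          deriv R η = s * R η / |deriv (fun τ => T (R τ • p)) η| ∧
          ∀ η₀ ∈ I, R η =
            R η₀ * Real.exp (∫ t in η₀..η, s / |deriv (fun τ => T (R τ • p)) t|)) ∧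
      -- the time is a monotonous function of `η`
      (∀ b, IsCanonicalBasis b → ∀ (J : Set ℝ) (R : ℝ → ℝ), J.OrdConnected →
        (∀ η ∈ J, R η ≠ 0 ∧ DifferentiableAt ℝ R η ∧ deriv R η ≠ 0) →
          ∃ F : ℝ → ℝ, (∀ q : Fin 4 → ℝ, q 0 ∈ J → T (sphericalPoint b R q) = F (q 0)) ∧
            (StrictMonoOn F J ∨ StrictAntiOn F J)) ∧
      -- the ether field in spherical coordinates
      (∀ b, IsCanonicalBasis b → ∀ (R : ℝ → ℝ) (q : Fin 4 → ℝ),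
        DifferentiableAt ℝ R (q 0) → R (q 0) ≠ 0 →
          DifferentiableAt ℝ (fun s => T (sphericalPoint b R (Function.update q 0 s))) (q 0) ∧
          ∀ α, lineDeriv ℝ T (sphericalPoint b R q) (sphericalFrame b R q α) =
            ![etaDeriv b R T q, 0, 0, 0] α) := by
  refine ⟨exists_isCosmology_quaternion hk, fun A _ _ _ _ R T h => h.exists_linearEquiv_quaternion,
    ⟨perceptionDomain_quaternion, perceptionDomain_quaternion_eq_range, Units.isOpenEmbedding_val,
      inferInstance, finrank_quaternion_real, nonempty_units_quaternion_homeomorph⟩,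
    fun b hb R R' q hR hR0 hR'0 h1 h2 => structureField_sphericalFrame hb R R' q hR hR0 hR'0 h1 h2,
    fun b hb u a ha J hJ hJ' h0 γ => hb.isVistaOn_iff u a ha hJ hJ' h0 γ, fun T hT => ?_⟩
  obtain ⟨f, hf⟩ := (isCosmology_quaternion_iff.1 hT).exists_hasRadialProfile hk
  refine ⟨hf.isClosedFLRW hk, ?_, fun s hs => hf.exists_radialFunction_eq_exp hk s hs,
    fun b hb J R hJ hR => hf.exists_strictMonoOn_or_strictAntiOn hk hb hJ hR,
    fun b hb R q hR hR0 => hf.lineDeriv_sphericalFrame hk hb R q hR hR0⟩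
  rcases hf.exists_sign hk with ⟨h, hmono⟩ | ⟨h, hanti⟩
  · refine ⟨1, Or.inl ⟨rfl, fun x y hx hxy => ?_⟩,
      fun b hb => hf.principalMetric_sphericalFrame hk hb (by simpa using h)⟩
    rw [hf.eq_norm x, hf.eq_norm y]
    exact hmono (norm_pos_iff.2 hx) ((norm_pos_iff.2 hx).trans hxy) hxy
  · refine ⟨-1, Or.inr ⟨rfl, fun x y hx hxy => ?_⟩,
      fun b hb => hf.principalMetric_sphericalFrame hk hb (by simpa using h)⟩
    rw [hf.eq_norm x, hf.eq_norm y]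
    exact hanti (norm_pos_iff.2 hx) ((norm_pos_iff.2 hx).trans hxy) hxy
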